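/- Let $d\ge 0$ and $k\ge 0$ be integers, and let $(M_n)_{n\ge1}$, $(N_n)_{n\ge1}$ be sequences of integers with $M_n\ge 2$, $1\le N_n\le M_n^d$ for all $n$ and $\sup_n M_n<\infty$. Put $r_n=\prod_{i=1}^n M_i^{-1}$, $P_n=\prod_{i=1}^n N_i$ and $$s=\liminf_{n\to\infty}\frac{\log P_n}{-\log r_n}.$$ Construct random sets as follows. $E_0=[0,1]^d$. Given $E_{n}$, a union of $P_{n}$ closed cubes of side $r_{n}$ of the $r_{n}$-adic grid, divide each of these cubes into $M_{n+1}^d$ closed subcubes of side $r_{n+1}$ and, independently for the different cubes, choose in each of them at random exactly $N_{n+1}$ of its subcubes, in such a way that each subcube has the same probability $N_{n+1}/M_{n+1}^d$ of being chosen (the joint distribution of the choices inside one cube is otherwise arbitrary). Let $E_{n+1}$ be the union of all the chosen subcubes, and let $E=\bigcap_{n\ge1}E_n$. If $s\le k$, then almost surely $\dim_H E=s$ and $$\dim_H \pi_V(E)=s\quad\text{for all } V\in G(d,k)\text{ simultaneously},$$ where $G(d,k)$ is the set of $k$-dimensional linear subspaces of $\mathbb{R}^d$, $\pi_V$ is the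 orthogonal projection onto $V$, and $\dim_H$ is Hausdorff dimension. -/

import Mathlib

noncomputable section

namespace RandomCantor

/- The two sequences of the construction are indexed from `0`: `M n` and `N n` are the numbers
used when passing from generation `n` to generation `n + 1`. -/

/-- The side length `r_n = ∏ (M i)⁻¹` of the grid cubes of generation `n`. -/
def sideLength (M : ℕ → ℕ) (n : ℕ) : ℝ := ∏ i ∈ Finset.range n, (M i : ℝ)⁻¹

/-- The number `P_n = ∏ N i` of chosen cubes of generation `n`. -/
def cubeCount (N : ℕ → ℕ) (n : ℕ) : ℕ := ∏ i ∈ Finset.range n, N i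

/-- The number `s = liminf (log P_n / (- log r_n))`. -/
def dimension (M N : ℕ → ℕ) : ℝ :=
  Filter.liminf (fun n : ℕ => Real.log (cubeCount N n) / (-Real.log (sideLength M n))) Filter.atTop

/-- The closed grid cube of generation `n` with lower corner `r_n • j`. For `j i < M 0 * ⋯ * M (n - 1)`
these are the `r_n`-adic closed subcubes of the unit cube. -/
def cube {d : ℕ} (M : ℕ → ℕ) (n : ℕ) (j : Fin d → ℕ) : Set (EuclideanSpace ℝ (Fin d)) :=
  {x | ∀ i, (j i : ℝ) * sideLength M n ≤ x i ∧ x i ≤ ((j i : ℝ) + 1) * sideLength M n}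

/-- The indices of the `m ^ d` subcubes obtained by dividing each side of the cube with index `j`
into `m` equal parts. -/
def children {d : ℕ} (m : ℕ) (j : Fin d → ℕ) : Finset (Fin d → ℕ) :=
  Fintype.piFinset fun i => Finset.Ico (m * j i) (m * j i + m)

/-- `C n ω` is the (index set of the) collection of chosen cubes of generation `n`. The collections
come from the following random construction. Start with the unit cube. Given the
collection of generation `n`, choose independently inside each of its cubes exactly `N n` of the
`M n ^ d` subcubes of the next generation, in such a way that each of these subcubes has the same
probability `N n / M n ^ d` of being chosen. The joint law of the subcubes chosen inside one cube
is otherwise arbitrary. A collection determines all the earlier ones, so conditioning on `C n` is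
conditioning on the whole past. -/
structure IsConstruction {d : ℕ} (M N : ℕ → ℕ) {Ω : Type*} [MeasurableSpace Ω]
    (P : MeasureTheory.Measure Ω) (C : ℕ → Ω → Finset (Fin d → ℕ)) : Prop where
  measurableSet_eq : ∀ (n : ℕ) (c : Finset (Fin d → ℕ)), MeasurableSet {ω | C n ω = c}
  zero : ∀ ω, C 0 ω = {0}
  /-- every chosen cube is a subcube of a chosen cube of the previous generation -/
  exists_parent : ∀ n ω, ∀ j ∈ C (n + 1) ω, ∃ q ∈ C n ω, j ∈ children (M n) q
  /-- exactly `N n` subcubes are chosen inside each chosen cube -/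
  card_chosen : ∀ n ω, ∀ q ∈ C n ω, (C (n + 1) ω ∩ children (M n) q).card = N n
  /-- given `C n`, the choices inside different cubes are independent -/
  indep : ∀ (n : ℕ) (c : Finset (Fin d → ℕ)), P {ω | C n ω = c} ≠ 0 →
    ProbabilityTheory.iIndepFun (m := fun _ => ⊤)
      (fun (q : {q // q ∈ c}) (ω : Ω) => C (n + 1) ω ∩ children (M n) (q : Fin d → ℕ))
      (ProbabilityTheory.cond P {ω | C n ω = c})
  /-- given `C n`, each subcube of a cube of `C n` has the same probability of being chosen -/
  prob_chosen : ∀ (n : ℕ) (c : Finset (Fin d → ℕ)), P {ω | C n ω = c} ≠ 0 →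
    ∀ q ∈ c, ∀ j ∈ children (M n) q,
      (ProbabilityTheory.cond P {ω | C n ω = c}).real {ω | j ∈ C (n + 1) ω}
        = (N n : ℝ) / (M n : ℝ) ^ d

/-- The union `E_n` of the chosen cubes of generation `n`. -/
def stage {d : ℕ} {Ω : Type*} (M : ℕ → ℕ) (C : ℕ → Ω → Finset (Fin d → ℕ)) (n : ℕ) (ω : Ω) :
    Set (EuclideanSpace ℝ (Fin d)) :=
  ⋃ j ∈ C n ω, cube M n j

/-- The random limit set `E = ⋂ E_n`. -/
def limitSet {d : ℕ} {Ω : Type*} (M : ℕ → ℕ) (C : ℕ → Ω → Finset (Fin d → ℕ)) (ω : Ω) :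
    Set (EuclideanSpace ℝ (Fin d)) :=
  ⋂ n : ℕ, stage M C (n + 1) ω

end RandomCantor

end

/-!
The upper bounds are deterministic: the `P_n` chosen cubes of side `r_n` cover the limit set `E`,
and projections are Lipschitz.

For the lower bounds let `u < t < s ≤ k`. The main point is that, almost surely, for all large `n`
and for *every* `V` of dimension `k`, a ball of radius `r_n` in `V` pulls back to at most
`P_n r_n ^ u` chosen cubes of generation `n`. A compactness argument, which replaces the usual
natural measure on `E`, turns this into `dimH (π_V E) ≥ u` (`le_dimH_image_starProjection`).

The pullbacks are replaced by a finite family. By Cramer's rule for a largest minor, `V` has a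
basis whose coordinates are bounded by `1` and form an identity matrix in `k` places
(`exists_adapted_basis`). Rounding the basis to multiples of `r_n` encloses every pullback in one of
at most exponentially many discrete `slabs` (`exists_subset_slab`), and each slab has
`O(l ^ (d - k))` members in each block of `l ^ d` cubes
(`card_filter_ancestor_le_of_mem_slabs`).

For a fixed slab `A`, weight a cube of generation `m ≤ n` by the number of members of `A` inside it.
Since the choices inside different cubes are conditionally independent and unbiased,
`exp x ≤ 1 + x + x ^ 2` bounds the exponential moment of the total weight of the chosen cubes of
generation `m + 1` by one of generation `m` with a slightly changed exponent
(`IsConstruction.integral_exp_succ_le`). As `P_m ≥ a r_m ^ (-t)` and `t ≤ k`, the exponent at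
generation `n` can be taken to be `1 / (n D P_n r_n ^ t)` while the moment stays bounded
(`IsConstruction.measureReal_card_inter_slab_le`). Hence the number of chosen cubes in a slab
exceeds a multiple of `n ^ 2 P_n r_n ^ t` only with a probability that beats the number of slabs,
and the Borel–Cantelli lemma applies.
-/

namespace RandomCantor

/-! ### Grid cubes and the tree of chosen cubes -/

/-- The number `M 0 * ⋯ * M (n - 1)` of grid cubes of generation `n` along each side of the unit
cube, that is, the reciprocal of `sideLength M n`. -/
def gridSize (M : ℕ → ℕ) (n : ℕ) : ℕ := ∏ i ∈ Finset.range n, M i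

/-- The number `M m * ⋯ * M (n - 1)` of grid cubes of generation `n` along each side of a cube of
generation `m ≤ n`. -/
def blockSize (M : ℕ → ℕ) (m n : ℕ) : ℕ := ∏ i ∈ Finset.Ico m n, M i

/-- The index of the cube that contains the cube `j` and has sides `l` times as long. -/
def ancestor {d : ℕ} (l : ℕ) (j : Fin d → ℕ) : Fin d → ℕ := fun i => j i / l

/-- The deterministic properties of a realization of the construction: `c n` is the set of indices
of the chosen cubes of generation `n`. -/
structure IsTree {d : ℕ} (M N : ℕ → ℕ) (c : ℕ → Finset (Fin d → ℕ)) : Prop where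
  zero : c 0 = {0}
  exists_parent : ∀ n, ∀ j ∈ c (n + 1), ∃ q ∈ c n, j ∈ children (M n) q
  card_chosen : ∀ n, ∀ q ∈ c n, (c (n + 1) ∩ children (M n) q).card = N n

theorem IsConstruction.isTree {d : ℕ} {M N : ℕ → ℕ} {Ω : Type*} [MeasurableSpace Ω]
    {P : MeasureTheory.Measure Ω} {C : ℕ → Ω → Finset (Fin d → ℕ)}
    (hC : IsConstruction M N P C) (ω : Ω) : IsTree M N (fun n => C n ω) where
  zero := hC.zero ω
  exists_parent n := hC.exists_parent n ω
  card_chosen n := hC.card_chosen n ω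

section sizes

variable {M N : ℕ → ℕ}

theorem sideLength_eq (M : ℕ → ℕ) (n : ℕ) : sideLength M n = (gridSize M n : ℝ)⁻¹ := by
  simp [sideLength, gridSize, Finset.prod_inv_distrib]

@[simp] theorem gridSize_zero (M : ℕ → ℕ) : gridSize M 0 = 1 := by simp [gridSize]

theorem gridSize_succ (M : ℕ → ℕ) (n : ℕ) : gridSize M (n + 1) = gridSize M n * M n := by
  simp [gridSize, Finset.prod_range_succ]

theorem cubeCount_succ (N : ℕ → ℕ) (n : ℕ) : cubeCount N (n + 1) = cubeCount N n * N n := by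
  simp [cubeCount, Finset.prod_range_succ]

theorem gridSize_mul_blockSize (M : ℕ → ℕ) {m n : ℕ} (h : m ≤ n) :
    gridSize M m * blockSize M m n = gridSize M n :=
  Finset.prod_range_mul_prod_Ico _ h

@[simp] theorem blockSize_self (M : ℕ → ℕ) (n : ℕ) : blockSize M n n = 1 := by simp [blockSize]

theorem blockSize_zero (M : ℕ → ℕ) (n : ℕ) : blockSize M 0 n = gridSize M n := by
  simp [blockSize, gridSize]

theorem blockSize_succ_right (M : ℕ → ℕ) {m n : ℕ} (h : m ≤ n) :
    blockSize M m (n + 1) = blockSize M m n * M n := by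
  simp [blockSize, Finset.prod_Ico_succ_top h]

theorem blockSize_succ_left (M : ℕ → ℕ) {m n : ℕ} (h : m < n) :
    blockSize M m n = M m * blockSize M (m + 1) n := by
  simp [blockSize, Finset.prod_eq_prod_Ico_succ_bot h]

theorem gridSize_pos (hM : ∀ n, 2 ≤ M n) (n : ℕ) : 0 < gridSize M n :=
  Finset.prod_pos fun i _ => by have := hM i; omega

theorem blockSize_pos (hM : ∀ n, 2 ≤ M n) (m n : ℕ) : 0 < blockSize M m n :=
  Finset.prod_pos fun i _ => by have := hM i; omega

theorem cubeCount_pos (hN : ∀ n, 1 ≤ N n) (n : ℕ) : 0 < cubeCount N n :=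
  Finset.prod_pos fun i _ => hN i

theorem two_pow_le_gridSize (hM : ∀ n, 2 ≤ M n) (n : ℕ) : 2 ^ n ≤ gridSize M n := by
  simpa [gridSize] using Finset.prod_le_prod' (s := Finset.range n) (f := fun _ => 2)
    (fun i _ => hM i)

theorem gridSize_le_pow {B : ℕ} (hB : ∀ n, M n ≤ B) (n : ℕ) : gridSize M n ≤ B ^ n := by
  simpa [gridSize] using Finset.prod_le_prod' (s := Finset.range n) (g := fun _ => B)
    (fun i _ => hB i)

theorem gridSize_mono (hM : ∀ n, 2 ≤ M n) : Monotone (gridSize M) :=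
  monotone_nat_of_le_succ fun n => by
    rw [gridSize_succ]
    exact Nat.le_mul_of_pos_right _ (by have := hM n; omega)

theorem cubeCount_le_gridSize_pow {d : ℕ} (hN : ∀ n, N n ≤ M n ^ d) (n : ℕ) :
    cubeCount N n ≤ gridSize M n ^ d := by
  rw [cubeCount, gridSize, ← Finset.prod_pow]
  exact Finset.prod_le_prod' fun i _ => hN i

theorem sideLength_pos (hM : ∀ n, 2 ≤ M n) (n : ℕ) : 0 < sideLength M n := by
  rw [sideLength_eq]
  have := gridSize_pos hM n
  positivity

end sizes

section ancestors

variable {d : ℕ}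

@[simp] theorem ancestor_one (j : Fin d → ℕ) : ancestor 1 j = j := by
  ext i; simp [ancestor]

theorem ancestor_ancestor (a b : ℕ) (j : Fin d → ℕ) :
    ancestor a (ancestor b j) = ancestor (a * b) j := by
  ext i; simp [ancestor, Nat.div_div_eq_div_mul, mul_comm]

theorem ancestor_eq_iff {l : ℕ} (hl : 0 < l) {j q : Fin d → ℕ} :
    ancestor l j = q ↔ ∀ i, l * q i ≤ j i ∧ j i < l * q i + l := by
  simp only [funext_iff, ancestor]
  refine forall_congr' fun i => ?_
  rw [Nat.div_eq_iff hl, mul_comm (q i) l]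
  omega

theorem mem_children {m : ℕ} (hm : 0 < m) {j q : Fin d → ℕ} :
    j ∈ children m q ↔ ancestor m j = q := by
  simp [children, ancestor_eq_iff hm]

end ancestors

namespace IsTree

variable {d : ℕ} {M N : ℕ → ℕ} {c : ℕ → Finset (Fin d → ℕ)}

theorem ancestor_mem_of_mem_succ (hc : IsTree M N c) (hM : ∀ n, 2 ≤ M n) {n : ℕ}
    {j : Fin d → ℕ} (hj : j ∈ c (n + 1)) : ancestor (M n) j ∈ c n := by
  obtain ⟨q, hq, hjq⟩ := hc.exists_parent n j hj
  rwa [(mem_children (by have := hM n; omega)).1 hjq]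

theorem ancestor_mem (hc : IsTree M N c) (hM : ∀ n, 2 ≤ M n) {m n : ℕ} (h : m ≤ n)
    {j : Fin d → ℕ} (hj : j ∈ c n) : ancestor (blockSize M m n) j ∈ c m := by
  induction n, h using Nat.le_induction generalizing j with
  | base => simpa using hj
  | succ n hmn ih =>
    rw [blockSize_succ_right M hmn, ← ancestor_ancestor]
    exact ih (hc.ancestor_mem_of_mem_succ hM hj)

theorem card_filter_ancestor_succ (hc : IsTree M N c) (hM : ∀ n, 2 ≤ M n) (n : ℕ)
    {S : Finset (Fin d → ℕ)} (hS : S ⊆ c n) :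
    ((c (n + 1)).filter fun j => ancestor (M n) j ∈ S).card = S.card * N n := by
  rw [Finset.card_eq_sum_card_fiberwise (f := ancestor (M n)) (t := S)
    (fun j hj => by simpa using (Finset.mem_filter.1 hj).2)]
  refine Finset.sum_const_nat fun q hq => ?_
  rw [← hc.card_chosen n q (hS hq)]
  congr 1
  ext j
  simp only [Finset.mem_filter, Finset.mem_inter, mem_children (show 0 < M n by have := hM n; omega)]
  constructor
  · rintro ⟨⟨h1, -⟩, h2⟩
    exact ⟨h1, h2⟩
  · rintro ⟨h1, h2⟩
    exact ⟨⟨h1, h2 ▸ hq⟩, h2⟩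

/-- Every chosen cube of generation `m` has `P_n / P_m` chosen descendants of generation `n`. -/
theorem card_filter_ancestor (hc : IsTree M N c) (hM : ∀ n, 2 ≤ M n) {m n : ℕ} (h : m ≤ n)
    {S : Finset (Fin d → ℕ)} (hS : S ⊆ c m) :
    ((c n).filter fun j => ancestor (blockSize M m n) j ∈ S).card * cubeCount N m
      = S.card * cubeCount N n := by
  induction n, h using Nat.le_induction with
  | base => simp [Finset.filter_mem_eq_inter, Finset.inter_eq_right.2 hS]
  | succ n hmn ih =>
    have key := hc.card_filter_ancestor_succ hM n
      (S := (c n).filter fun j => ancestor (blockSize M m n) j ∈ S) (Finset.filter_subset _ _)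
    have heq : ((c (n + 1)).filter fun j => ancestor (blockSize M m (n + 1)) j ∈ S)
        = (c (n + 1)).filter fun j =>
          ancestor (M n) j ∈ (c n).filter fun j => ancestor (blockSize M m n) j ∈ S := by
      ext j
      simp only [Finset.mem_filter, blockSize_succ_right M hmn, ancestor_ancestor]
      constructor
      · rintro ⟨h1, h2⟩
        exact ⟨h1, hc.ancestor_mem_of_mem_succ hM h1, h2⟩
      · rintro ⟨h1, -, h2⟩
        exact ⟨h1, h2⟩
    rw [heq, key, cubeCount_succ, mul_right_comm, ih, mul_assoc]

theorem card_eq (hc : IsTree M N c) (hM : ∀ n, 2 ≤ M n) (n : ℕ) :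
    (c n).card = cubeCount N n := by
  induction n with
  | zero => simp [hc.zero, cubeCount]
  | succ n ih =>
    rw [cubeCount_succ, ← ih, ← hc.card_filter_ancestor_succ hM n subset_rfl,
      Finset.filter_true_of_mem fun j hj => hc.ancestor_mem_of_mem_succ hM hj]

theorem lt_gridSize (hc : IsTree M N c) (hM : ∀ n, 2 ≤ M n) {n : ℕ} {j : Fin d → ℕ}
    (hj : j ∈ c n) (i : Fin d) : j i < gridSize M n := by
  have h := hc.ancestor_mem hM (Nat.zero_le n) hj
  rw [hc.zero, Finset.mem_singleton, blockSize_zero,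
    ancestor_eq_iff (gridSize_pos hM n)] at h
  simpa using (h i).2

end IsTree

section cubes

variable {d : ℕ} {M N : ℕ → ℕ}

theorem mem_cube_iff (hM : ∀ n, 2 ≤ M n) {n : ℕ} {j : Fin d → ℕ} {x : EuclideanSpace ℝ (Fin d)} :
    x ∈ cube M n j ↔ ∀ i, (j i : ℝ) ≤ x i * gridSize M n ∧ x i * gridSize M n ≤ j i + 1 := by
  have := gridSize_pos hM n
  have hR : (0 : ℝ) < gridSize M n := by exact_mod_cast this
  simp only [cube, Set.mem_ofPred_eq, sideLength_eq, ← div_eq_mul_inv]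
  refine forall_congr' fun i => ?_
  rw [div_le_iff₀ hR, le_div_iff₀ hR]

theorem cube_subset_cube_ancestor (hM : ∀ n, 2 ≤ M n) {m n : ℕ} (h : m ≤ n) (j : Fin d → ℕ) :
    cube M n j ⊆ cube M m (ancestor (blockSize M m n) j) := by
  intro x hx
  rw [mem_cube_iff hM] at hx ⊢
  intro i
  obtain ⟨h1, h2⟩ := hx i
  have hL : (0 : ℝ) < blockSize M m n := by exact_mod_cast blockSize_pos hM m n
  have hd := (ancestor_eq_iff (blockSize_pos hM m n) (j := j)).1 rfl i
  have hR : (gridSize M n : ℝ) = gridSize M m * blockSize M m n := by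
    exact_mod_cast (gridSize_mul_blockSize M h).symm
  rw [hR, ← mul_assoc] at h1 h2
  have hd1 : (blockSize M m n : ℝ) * (ancestor (blockSize M m n) j i : ℕ) ≤ j i := by
    exact_mod_cast hd.1
  have hd2 : (j i : ℝ) + 1
      ≤ blockSize M m n * (ancestor (blockSize M m n) j i : ℕ) + blockSize M m n := by
    exact_mod_cast hd.2
  constructor
  · refine le_of_mul_le_mul_right ?_ hL
    linarith
  · refine le_of_mul_le_mul_right ?_ hL
    linarith

theorem isCompact_cube (n : ℕ) (j : Fin d → ℕ) : IsCompact (cube M n j) := by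
  have h : cube M n j = EuclideanSpace.equiv (Fin d) ℝ ⁻¹'
      Set.Icc (fun i => (j i : ℝ) * sideLength M n) (fun i => ((j i : ℝ) + 1) * sideLength M n) := by
    ext x
    simp [cube, Pi.le_def, forall_and]
  rw [h]
  exact (EuclideanSpace.equiv (Fin d) ℝ).toHomeomorph.isCompact_preimage.2 isCompact_Icc

theorem corner_mem_cube (hM : ∀ n, 2 ≤ M n) (n : ℕ) (j : Fin d → ℕ) :
    WithLp.toLp 2 (fun i => (j i : ℝ) * sideLength M n) ∈ cube M n j := by
  intro i
  have := sideLength_pos hM n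
  constructor
  · simp
  · simp only
    nlinarith

variable {Ω : Type*} {C : ℕ → Ω → Finset (Fin d → ℕ)} {ω : Ω}

theorem isCompact_stage (n : ℕ) : IsCompact (stage M C n ω) :=
  (C n ω).isCompact_biUnion fun j _ => isCompact_cube n j

theorem stage_antitone (hc : IsTree M N (fun n => C n ω)) (hM : ∀ n, 2 ≤ M n) :
    Antitone fun n => stage M C n ω := by
  intro m n h x hx
  simp only [stage, Set.mem_iUnion] at hx ⊢
  obtain ⟨j, hj, hx⟩ := hx
  exact ⟨_, hc.ancestor_mem hM h hj, cube_subset_cube_ancestor hM h j hx⟩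

theorem limitSet_subset_stage (hc : IsTree M N (fun n => C n ω)) (hM : ∀ n, 2 ≤ M n) (n : ℕ) :
    limitSet M C ω ⊆ stage M C n ω :=
  (Set.iInter_subset _ n).trans (stage_antitone hc hM (Nat.le_succ n))

theorem isCompact_limitSet : IsCompact (limitSet M C ω) :=
  (isCompact_stage 1).of_isClosed_subset
    (isClosed_iInter fun n => (isCompact_stage (n + 1)).isClosed) (Set.iInter_subset _ 0)

/-- An open set containing the limit set contains all late generations. -/
theorem exists_stage_subset (hc : IsTree M N (fun n => C n ω)) (hM : ∀ n, 2 ≤ M n)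
    {U : Set (EuclideanSpace ℝ (Fin d))} (hU : IsOpen U) (h : limitSet M C ω ⊆ U) :
    ∃ n₀, ∀ n ≥ n₀, stage M C n ω ⊆ U := by
  have hanti := stage_antitone hc hM
  obtain ⟨n, hn⟩ := exists_subset_nhds_of_isCompact (V := fun n => stage M C (n + 1) ω)
    (fun a b => ⟨max a b, hanti (by omega), hanti (by omega)⟩)
    (fun n => isCompact_stage (n + 1)) (fun x hx => hU.mem_nhds (h hx))
  exact ⟨n + 1, fun m hm => (hanti hm).trans hn⟩

end cubes

/-! ### The exponent `s` and the upper bound for the dimension -/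

section exponent

open Filter

variable {d : ℕ} {M N : ℕ → ℕ}

theorem neg_log_sideLength (M : ℕ → ℕ) (n : ℕ) :
    -Real.log (sideLength M n) = Real.log (gridSize M n) := by
  rw [sideLength_eq, Real.log_inv, neg_neg]

theorem log_gridSize_pos (hM : ∀ n, 2 ≤ M n) {n : ℕ} (hn : n ≠ 0) :
    0 < Real.log (gridSize M n) := by
  refine Real.log_pos ?_
  have h1 := two_pow_le_gridSize hM n
  have h2 : 1 < 2 ^ n := Nat.one_lt_two_pow hn
  exact_mod_cast h2.trans_le h1

theorem log_ratio_nonneg (hM : ∀ n, 2 ≤ M n) (hN : ∀ n, 1 ≤ N n) (n : ℕ) :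
    0 ≤ Real.log (cubeCount N n) / (-Real.log (sideLength M n)) := by
  rw [neg_log_sideLength]
  have h1 := gridSize_pos hM n
  have h2 := cubeCount_pos hN n
  exact div_nonneg (Real.log_nonneg (by exact_mod_cast h2)) (Real.log_nonneg (by exact_mod_cast h1))

theorem log_ratio_le (hM : ∀ n, 2 ≤ M n) (hN : ∀ n, 1 ≤ N n ∧ N n ≤ M n ^ d) (n : ℕ) :
    Real.log (cubeCount N n) / (-Real.log (sideLength M n)) ≤ d := by
  rw [neg_log_sideLength]
  have h1 := gridSize_pos hM n
  have h2 := cubeCount_pos (fun n => (hN n).1) n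
  have h3 := cubeCount_le_gridSize_pow (fun n => (hN n).2) n
  refine div_le_of_le_mul₀ (Real.log_nonneg (by exact_mod_cast h1)) (by positivity) ?_
  rw [← Real.log_pow]
  exact Real.log_le_log (by exact_mod_cast h2) (by exact_mod_cast h3)

theorem dimension_nonneg (hM : ∀ n, 2 ≤ M n) (hN : ∀ n, 1 ≤ N n ∧ N n ≤ M n ^ d) :
    0 ≤ dimension M N :=
  le_liminf_of_le (isBoundedUnder_of ⟨(d : ℝ), log_ratio_le hM hN⟩).isCoboundedUnder_ge
    (Eventually.of_forall (log_ratio_nonneg hM fun n => (hN n).1))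

theorem dimension_le (hM : ∀ n, 2 ≤ M n) (hN : ∀ n, 1 ≤ N n ∧ N n ≤ M n ^ d) :
    dimension M N ≤ d :=
  liminf_le_of_frequently_le (Frequently.of_forall (log_ratio_le hM hN))
    (isBoundedUnder_of ⟨(0 : ℝ), log_ratio_nonneg hM fun n => (hN n).1⟩)

theorem exists_mul_rpow_le_cubeCount (hM : ∀ n, 2 ≤ M n) (hN : ∀ n, 1 ≤ N n) {t : ℝ} (ht0 : 0 ≤ t)
    (ht : t < dimension M N) :
    ∃ a : ℝ, 0 < a ∧ ∀ n, a * (gridSize M n : ℝ) ^ t ≤ cubeCount N n := by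
  have hev := eventually_lt_of_lt_liminf ht
    (isBoundedUnder_of ⟨(0 : ℝ), log_ratio_nonneg hM hN⟩)
  obtain ⟨n₀, hn₀⟩ := eventually_atTop.1 hev
  have hR : ∀ n, (1 : ℝ) ≤ gridSize M n := fun n => by exact_mod_cast gridSize_pos hM n
  have hP : ∀ n, (1 : ℝ) ≤ cubeCount N n := fun n => by exact_mod_cast cubeCount_pos hN n
  have hA : ∀ n, 0 < (gridSize M n : ℝ) ^ t := fun n => Real.rpow_pos_of_pos (by linarith [hR n]) t
  refine ⟨((gridSize M (n₀ + 1) : ℝ) ^ t)⁻¹, inv_pos.2 (hA _), fun n => ?_⟩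
  rw [← div_eq_inv_mul, div_le_iff₀ (hA _)]
  rcases le_total n (n₀ + 1) with h | h
  · calc (gridSize M n : ℝ) ^ t ≤ (gridSize M (n₀ + 1) : ℝ) ^ t :=
          Real.rpow_le_rpow (by linarith [hR n]) (by exact_mod_cast gridSize_mono hM h) ht0
      _ ≤ _ := le_mul_of_one_le_left (hA _).le (hP n)
  · have h1 := hn₀ n (by omega)
    rw [neg_log_sideLength, lt_div_iff₀ (log_gridSize_pos hM (by omega))] at h1
    calc (gridSize M n : ℝ) ^ t ≤ cubeCount N n := by
          rw [← Real.log_le_log_iff (hA n) (by linarith [hP n]),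
            Real.log_rpow (by linarith [hR n])]
          exact h1.le
      _ ≤ _ := le_mul_of_one_le_right (by linarith [hP n]) (Real.one_le_rpow (hR _) ht0)

theorem frequently_cubeCount_le_rpow (hM : ∀ n, 2 ≤ M n) (hN : ∀ n, 1 ≤ N n ∧ N n ≤ M n ^ d)
    {t : ℝ} (ht : dimension M N < t) :
    ∃ᶠ n in atTop, (cubeCount N n : ℝ) ≤ (gridSize M n : ℝ) ^ t := by
  have hfr := frequently_lt_of_liminf_lt
    (isBoundedUnder_of ⟨(d : ℝ), log_ratio_le hM hN⟩).isCoboundedUnder_ge ht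
  refine (hfr.and_eventually (eventually_gt_atTop 0)).mono fun n hn => ?_
  obtain ⟨h1, h2⟩ := hn
  have hR : (1 : ℝ) ≤ gridSize M n := by exact_mod_cast gridSize_pos hM n
  have hP : (1 : ℝ) ≤ cubeCount N n := by exact_mod_cast cubeCount_pos (fun n => (hN n).1) n
  rw [neg_log_sideLength, div_lt_iff₀ (log_gridSize_pos hM (by omega))] at h1
  rw [← Real.log_le_log_iff (by linarith) (Real.rpow_pos_of_pos (by linarith) t),
    Real.log_rpow (by linarith)]
  exact h1.le

end exponent

section upperBound

open Filter MeasureTheory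
open scoped ENNReal Topology

variable {d : ℕ} {M N : ℕ → ℕ}

theorem ediam_cube_le (hM : ∀ n, 2 ≤ M n) (n : ℕ) (j : Fin d → ℕ) :
    Metric.ediam (cube M n j) ≤ ENNReal.ofReal (√d * sideLength M n) := by
  refine Metric.ediam_le fun x hx y hy => ?_
  rw [edist_dist]
  refine ENNReal.ofReal_le_ofReal ?_
  have hr := (sideLength_pos hM n).le
  rw [EuclideanSpace.dist_eq]
  calc √(∑ i, dist (x i) (y i) ^ 2) ≤ √(∑ _i : Fin d, sideLength M n ^ 2) := by
        refine Real.sqrt_le_sqrt (Finset.sum_le_sum fun i _ => ?_)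
        refine pow_le_pow_left₀ dist_nonneg ?_ 2
        rw [Real.dist_eq, abs_le]
        constructor <;> linarith [hx i, hy i, (hx i).1, (hx i).2, (hy i).1, (hy i).2]
    _ = √d * sideLength M n := by
        rw [Finset.sum_const, Finset.card_univ, Fintype.card_fin, nsmul_eq_mul,
          Real.sqrt_mul (by positivity), Real.sqrt_sq hr]

variable {Ω : Type*} {C : ℕ → Ω → Finset (Fin d → ℕ)} {ω : Ω}

/-- The `P_n` chosen cubes of side `r_n` cover the limit set. -/
theorem dimH_limitSet_le (hc : IsTree M N (fun n => C n ω)) (hM : ∀ n, 2 ≤ M n)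
    (hN : ∀ n, 1 ≤ N n ∧ N n ≤ M n ^ d) :
    dimH (limitSet M C ω) ≤ ENNReal.ofReal (dimension M N) := by
  refine le_of_forall_gt_imp_ge_of_dense fun b hb => ?_
  rcases eq_or_ne b ⊤ with rfl | hbt
  · exact le_top
  lift b to NNReal using hbt
  have hs : dimension M N < b :=
    (ENNReal.ofReal_lt_iff_lt_toReal (dimension_nonneg hM hN) ENNReal.coe_ne_top).1 hb
  refine dimH_le_of_hausdorffMeasure_ne_top (ne_top_of_le_ne_top ?_
    (Measure.hausdorffMeasure_le_liminf_sum (ι := fun n => {j // j ∈ C n ω}) (l := atTop) b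
      (limitSet M C ω) (fun n => ENNReal.ofReal (√d * sideLength M n)) ?_
      (fun n j => cube M n j.1) (Eventually.of_forall fun n j => ediam_cube_le hM n j.1)
      (Eventually.of_forall fun n => ?_)))
  · refine ne_top_of_le_ne_top (ENNReal.ofReal_ne_top (r := √d ^ (b : ℝ)))
      (liminf_le_of_frequently_le ?_)
    refine (frequently_cubeCount_le_rpow hM hN hs).mono fun n hn => ?_
    have hR : (0 : ℝ) < gridSize M n := by exact_mod_cast gridSize_pos hM n
    calc ∑ j : {j // j ∈ C n ω}, Metric.ediam (cube M n j.1) ^ (b : ℝ)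
        ≤ ∑ _j : {j // j ∈ C n ω}, ENNReal.ofReal ((√d * sideLength M n) ^ (b : ℝ)) := by
          refine Finset.sum_le_sum fun j _ => ?_
          rw [← ENNReal.ofReal_rpow_of_nonneg (by have := sideLength_pos hM n; positivity)
            b.coe_nonneg]
          exact ENNReal.rpow_le_rpow (ediam_cube_le hM n j.1) b.coe_nonneg
      _ = ENNReal.ofReal (cubeCount N n * (√d * sideLength M n) ^ (b : ℝ)) := by
          rw [ENNReal.ofReal_mul (by positivity), ENNReal.ofReal_natCast, Finset.sum_const,
            nsmul_eq_mul, Finset.card_univ, Fintype.card_coe, hc.card_eq hM]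
      _ ≤ ENNReal.ofReal (√d ^ (b : ℝ)) := by
          refine ENNReal.ofReal_le_ofReal ?_
          rw [sideLength_eq, Real.mul_rpow (by positivity) (by positivity),
            Real.inv_rpow hR.le, mul_left_comm, ← div_eq_mul_inv]
          exact mul_le_of_le_one_right (by positivity)
            ((div_le_one (by positivity)).2 hn)
  · rw [← ENNReal.ofReal_zero]
    refine ENNReal.tendsto_ofReal ?_
    have h : Tendsto (fun n => sideLength M n) atTop (𝓝 0) := by
      refine squeeze_zero (fun n => (sideLength_pos hM n).le) (fun n => ?_)
        (tendsto_pow_atTop_nhds_zero_of_lt_one (r := (2 : ℝ)⁻¹) (by norm_num) (by norm_num))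
      rw [sideLength_eq, inv_pow]
      exact inv_anti₀ (by positivity) (by exact_mod_cast two_pow_le_gridSize hM n)
    simpa using h.const_mul √d
  · intro x hx
    have := limitSet_subset_stage hc hM n hx
    simpa [stage] using this

end upperBound

/-! ### Bases adapted to the coordinates -/

section adapted

open Matrix

/-- A `k × d` matrix whose rows are linearly independent can be brought, by multiplication from the
left, to a form with the identity matrix in some columns and all entries at most `1` in absolute
value: choose the columns of a largest minor and use Cramer's rule. -/
theorem exists_mul_submatrix_eq_one {d k : ℕ} (A : Matrix (Fin k) (Fin d) ℝ)
    (hA : LinearIndependent ℝ A.row) :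
    ∃ (I : Fin k → Fin d) (S : Matrix (Fin k) (Fin k) ℝ),
      (S * A).submatrix id I = 1 ∧ ∀ i l, |(S * A) i l| ≤ 1 := by
  have hrank : ∃ I : Fin k → Fin d, (A.submatrix id I).det ≠ 0 := by
    obtain ⟨f, hf, -, hli⟩ := Submodule.exists_fun_fin_finrank_span_eq ℝ (Set.range A.col)
    have hfin : Module.finrank ℝ (Submodule.span ℝ (Set.range A.col)) = k := by
      rw [← Matrix.rank_eq_finrank_span_cols, hA.rank_matrix, Fintype.card_fin]
    choose I hI using hf
    refine ⟨fun i => I (Fin.cast hfin.symm i), ?_⟩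
    have hli' : LinearIndependent ℝ
        (A.submatrix id fun i => I (Fin.cast hfin.symm i)).col := by
      have h : (A.submatrix id fun i => I (Fin.cast hfin.symm i)).col
          = f ∘ Fin.cast hfin.symm := by
        ext i a
        simp [← hI, Matrix.col_apply]
      rw [h]
      exact hli.comp _ (Fin.cast_injective _)
    rw [Matrix.linearIndependent_cols_iff_isUnit] at hli'
    exact ((Matrix.isUnit_iff_isUnit_det _).1 hli').ne_zero
  obtain ⟨I₀, hI₀⟩ := hrank
  obtain ⟨I, -, hI⟩ := Finset.exists_max_image (Finset.univ : Finset (Fin k → Fin d))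
    (fun I => |(A.submatrix id I).det|) ⟨I₀, Finset.mem_univ _⟩
  have hdet : (A.submatrix id I).det ≠ 0 := by
    have := hI I₀ (Finset.mem_univ _)
    have h0 := abs_pos.2 hI₀
    exact abs_pos.1 (h0.trans_le this)
  refine ⟨I, (A.submatrix id I)⁻¹, ?_, fun i l => ?_⟩
  · have : ((A.submatrix id I)⁻¹ * A).submatrix id I
        = (A.submatrix id I)⁻¹ * A.submatrix id I := by
      ext i j; simp [Matrix.mul_apply]
    rw [this, Matrix.nonsing_inv_mul _ (isUnit_iff_ne_zero.2 hdet)]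
  · have h1 : ((A.submatrix id I)⁻¹ * A) i l
        = (A.submatrix id I).det⁻¹ * (A.submatrix id (Function.update I i l)).det := by
      have h2 : ((A.submatrix id I).updateCol i (A.col l))
          = A.submatrix id (Function.update I i l) := by
        ext a b
        by_cases hb : b = i
        · subst hb; simp
        · simp [hb]
      rw [← h2, ← Matrix.cramer_apply, Matrix.cramer_eq_adjugate_mulVec, Matrix.inv_def,
        Ring.inverse_eq_inv']
      simp [Matrix.mul_apply, Matrix.mulVec, dotProduct, Finset.mul_sum, mul_assoc]
    rw [h1, abs_mul, abs_inv, ← div_eq_inv_mul, div_le_one (abs_pos.2 hdet)]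
    exact hI _ (Finset.mem_univ _)

/-- A `k`-dimensional subspace `V` has a basis `v i` such that, for suitable coordinates `I i`,
the coordinates `I i'` of `v i` are those of the unit vectors, and all
coordinates of `v i` are at most `1` in absolute value. -/
theorem exists_adapted_basis {d k : ℕ} (V : Submodule ℝ (EuclideanSpace ℝ (Fin d)))
    (hV : Module.finrank ℝ V = k) :
    ∃ (I : Fin k → Fin d) (v : Fin k → EuclideanSpace ℝ (Fin d)),
      (∀ i, v i ∈ V) ∧ (∀ i i', v i (I i') = if i = i' then 1 else 0) ∧ ∀ i l, |v i l| ≤ 1 := by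
  let b := Module.finBasisOfFinrankEq ℝ V hV
  let A : Matrix (Fin k) (Fin d) ℝ := Matrix.of fun i l => (b i : EuclideanSpace ℝ (Fin d)) l
  have hA : LinearIndependent ℝ A.row := by
    have h1 : LinearIndependent ℝ fun i => (b i : EuclideanSpace ℝ (Fin d)) :=
      b.linearIndependent.map' V.subtype V.ker_subtype
    exact h1.map' (EuclideanSpace.equiv (Fin d) ℝ).toLinearEquiv.toLinearMap
      (LinearEquiv.ker _)
  obtain ⟨I, S, hone, hle⟩ := exists_mul_submatrix_eq_one A hA
  have hv : ∀ i l, (∑ i', S i i' • (b i' : EuclideanSpace ℝ (Fin d))) l = (S * A) i l := by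
    intro i l
    simp [Matrix.mul_apply, A, WithLp.ofLp_sum]
  refine ⟨I, fun i => ∑ i', S i i' • (b i' : EuclideanSpace ℝ (Fin d)), fun i => ?_,
    fun i i' => ?_, fun i l => ?_⟩
  · exact V.sum_mem fun i' _ => V.smul_mem _ (b i').2
  · rw [hv, ← Matrix.one_apply, ← hone]; rfl
  · rw [hv]; exact hle i l

end adapted

/-! ### Discrete slabs -/

section slabs

variable {d k : ℕ}

/-- The discrete slab of grid cubes of side `1 / R` whose indices nearly satisfy the `k` equations
with integer coefficients `T` that hold at `j₀`. The coefficients are of size `R`, so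
the slab models an `O(1 / R)`-neighbourhood of a plane of codimension `k` in the unit cube. -/
noncomputable def slab (R : ℕ) (T : Fin k → Fin d → ℤ) (j₀ : Fin d → ℕ) : Finset (Fin d → ℕ) :=
  (Fintype.piFinset fun _ => Finset.range R).filter fun j =>
    ∀ i, |∑ l, T i l * ((j l : ℤ) - j₀ l)| ≤ 4 * d * R

/-- The family of all slabs of mesh `1 / R` and codimension `k` whose equations are, up to the
common factor `R`, in reduced form: the coefficients are at most `R` in absolute value and, in the
`k` coordinates `I`, they form `R` times the identity matrix. -/
noncomputable def slabs (d k R : ℕ) : Finset (Finset (Fin d → ℕ)) :=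
  (((Fintype.piFinset fun _ : Fin k => Fintype.piFinset fun _ : Fin d =>
      Finset.Icc (-(R : ℤ)) R) ×ˢ (Fintype.piFinset fun _ : Fin d => Finset.range R)).filter
    fun p => ∃ I : Fin k → Fin d, ∀ i i', p.1 i (I i') = if i = i' then (R : ℤ) else 0).image
    fun p => slab R p.1 p.2

theorem card_slabs_le {R : ℕ} (hR : 0 < R) : (slabs d k R).card ≤ (3 * R) ^ (d * k + d) := by
  refine (Finset.card_image_le.trans (Finset.card_filter_le _ _)).trans ?_
  have h1 : (Finset.Icc (-(R : ℤ)) R).card = 2 * R + 1 := by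
    rw [Int.card_Icc]; omega
  simp only [Finset.card_product, Fintype.card_piFinset, Finset.prod_const, Finset.card_univ,
    Fintype.card_fin, Finset.card_range, h1]
  rw [← pow_mul, pow_add]
  exact Nat.mul_le_mul (Nat.pow_le_pow_left (by omega) _) (Nat.pow_le_pow_left (by omega) _)

theorem injective_of_reduced {R : ℕ} (hR : 0 < R) {T : Fin k → Fin d → ℤ} {I : Fin k → Fin d}
    (hI : ∀ i i', T i (I i') = if i = i' then (R : ℤ) else 0) : Function.Injective I := by
  intro a b hab
  by_contra hne
  have h1 := hI a a
  have h2 := hI a b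
  rw [if_neg hne, ← hab, h1, if_pos rfl] at h2
  omega

/-- A slab of codimension `k` contains `O(L ^ (d - k))` of the `L ^ d` cubes of a block: if the
coordinates outside `I` are fixed, then each coordinate in `I` lies in an interval of
length `8 * d`, so it is determined by its residue modulo `8 * d + 1`. -/
theorem card_filter_ancestor_le_of_mem_slabs {R L : ℕ} (hR : 0 < R) (hL : 0 < L)
    {A : Finset (Fin d → ℕ)} (hA : A ∈ slabs d k R) (q : Fin d → ℕ) :
    (A.filter fun j => ancestor L j = q).card * L ^ k ≤ (8 * d + 1) ^ k * L ^ d := by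
  simp only [slabs, Finset.mem_image, Finset.mem_filter, Prod.exists] at hA
  obtain ⟨T, j₀, ⟨-, I, hI⟩, rfl⟩ := hA
  have hR' : (0 : ℤ) < R := by exact_mod_cast hR
  have hinj := injective_of_reduced hR hI
  set J : Finset (Fin d) := Finset.univ.image I with hJ
  have hJcard : J.card = k := by
    rw [hJ, Finset.card_image_of_injective _ hinj, Finset.card_univ, Fintype.card_fin]
  have hkd : k ≤ d := by
    rw [← hJcard]; exact (Finset.card_le_univ J).trans (Fintype.card_fin d).le
  have hcard : ((slab R T j₀).filter fun j => ancestor L j = q).card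
      ≤ (Fintype.piFinset fun l => if l ∈ J then Finset.range (8 * d + 1)
          else Finset.Ico (L * q l) (L * q l + L)).card := by
    refine Finset.card_le_card_of_injOn
      (fun j l => if l ∈ J then j l % (8 * d + 1) else j l) (fun j hj => ?_) ?_
    · simp only [Finset.coe_filter, Set.mem_ofPred_eq] at hj
      have hj2 := (ancestor_eq_iff hL).1 hj.2
      simp only [Finset.mem_coe, Fintype.mem_piFinset]
      intro l
      by_cases hl : l ∈ J
      · simpa [hl] using Nat.le_of_lt_succ (Nat.mod_lt (j l) (Nat.succ_pos (8 * d)))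
      · simpa [hl] using hj2 l
    · intro j hj j' hj' heq
      simp only [Finset.coe_filter, Set.mem_ofPred_eq, slab, Finset.mem_filter] at hj hj'
      have hout : ∀ l, l ∉ J → j l = j' l := fun l hl => by
        have := congrFun heq l
        simpa [hl] using this
      funext l
      by_cases hl : l ∈ J
      swap
      · exact hout l hl
      obtain ⟨i, -, rfl⟩ := Finset.mem_image.1 hl
      have hmod : j (I i) % (8 * d + 1) = j' (I i) % (8 * d + 1) := by
        have := congrFun heq (I i)
        simpa [hl] using this
      have hsum : ∑ l, T i l * ((j l : ℤ) - j₀ l) - ∑ l, T i l * ((j' l : ℤ) - j₀ l)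
          = R * ((j (I i) : ℤ) - j' (I i)) := by
        rw [← Finset.sum_sub_distrib, Finset.sum_eq_single (I i)]
        · rw [hI i i, if_pos rfl]; ring
        · intro l _ hne
          by_cases hlJ : l ∈ J
          · obtain ⟨i', -, rfl⟩ := Finset.mem_image.1 hlJ
            rw [hI i i', if_neg (fun h => hne (by rw [h]))]; ring
          · rw [hout l hlJ]; ring
        · simp
      have habs : |(R : ℤ) * ((j (I i) : ℤ) - j' (I i))| ≤ R * (8 * d) := by
        rw [← hsum]
        refine (abs_sub _ _).trans ((add_le_add (hj.1.2 i) (hj'.1.2 i)).trans (le_of_eq ?_))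
        ring
      rw [abs_mul, abs_of_pos hR'] at habs
      have hle := le_of_mul_le_mul_left habs hR'
      have hdvd : ((8 * d + 1 : ℕ) : ℤ) ∣ (j (I i) : ℤ) - j' (I i) :=
        (Nat.modEq_iff_dvd.1 (show j' (I i) ≡ j (I i) [MOD 8 * d + 1] from hmod.symm))
      have hzero := Int.eq_zero_of_abs_lt_dvd hdvd (by push_cast; omega)
      omega
  have hprod : (Fintype.piFinset fun l => if l ∈ J then Finset.range (8 * d + 1)
      else Finset.Ico (L * q l) (L * q l + L)).card = (8 * d + 1) ^ k * L ^ (d - k) := by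
    rw [Fintype.card_piFinset]
    have : ∀ l, (if l ∈ J then Finset.range (8 * d + 1)
        else Finset.Ico (L * q l) (L * q l + L)).card = if l ∈ J then 8 * d + 1 else L := by
      intro l; split_ifs <;> simp
    simp only [this]
    rw [Finset.prod_ite]
    simp only [Finset.prod_const, Finset.filter_mem_eq_inter, Finset.univ_inter, hJcard,
      Finset.filter_not, Finset.card_univ_sdiff, Fintype.card_fin]
  calc _ ≤ (8 * d + 1) ^ k * L ^ (d - k) * L ^ k := Nat.mul_le_mul_right _ (hcard.trans hprod.le)
    _ = _ := by rw [mul_assoc, ← pow_add, Nat.sub_add_cancel hkd]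

/-- If the projections to a `k`-dimensional subspace of some grid cubes of side `r_n` are at
distance at most `r_n` from each other, then the cubes belong to one slab of the finite family
`slabs d k (gridSize M n)`. -/
theorem exists_subset_slab {M : ℕ → ℕ} (hM : ∀ n, 2 ≤ M n)
    (V : Submodule ℝ (EuclideanSpace ℝ (Fin d))) (hV : Module.finrank ℝ V = k) (n : ℕ)
    {F : Finset (Fin d → ℕ)} (hF : F.Nonempty) (hgrid : ∀ j ∈ F, ∀ i, j i < gridSize M n)
    (hnear : ∀ j ∈ F, ∀ j' ∈ F, ∃ y ∈ cube M n j, ∃ y' ∈ cube M n j',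
      dist (V.starProjection y) (V.starProjection y') ≤ sideLength M n) :
    ∃ A ∈ slabs d k (gridSize M n), F ⊆ A := by
  obtain ⟨I, v, hvV, hvI, hv1⟩ := exists_adapted_basis V hV
  obtain ⟨j₀, hj₀⟩ := hF
  set R := gridSize M n with hRdef
  have hR : (0 : ℝ) < R := by exact_mod_cast gridSize_pos hM n
  set T : Fin k → Fin d → ℤ := fun i l => ⌊v i l * R⌋ with hT
  refine ⟨slab R T j₀, ?_, fun j hj => ?_⟩
  · simp only [slabs, Finset.mem_image, Finset.mem_filter, Prod.exists, Finset.mem_product,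
      Fintype.mem_piFinset, Finset.mem_range, Finset.mem_Icc]
    refine ⟨T, j₀, ⟨⟨fun i l => ?_, hgrid j₀ hj₀⟩, I, fun i i' => ?_⟩, rfl⟩
    · have h := abs_le.1 (hv1 i l)
      constructor
      · refine Int.le_floor.2 ?_
        push_cast
        nlinarith
      · have : (⌊v i l * R⌋ : ℝ) ≤ R := (Int.floor_le _).trans (by nlinarith)
        exact_mod_cast this
    · simp only [hT, hvI]
      split_ifs <;> simp
  · simp only [slab, Finset.mem_filter, Fintype.mem_piFinset, Finset.mem_range]
    refine ⟨hgrid j hj, fun i => ?_⟩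
    obtain ⟨y, hy, y', hy', hdist⟩ := hnear j hj j₀ hj₀
    rw [mem_cube_iff hM] at hy hy'
    -- pairing with `v i ∈ V` only sees the projection to `V`
    have hpair : ∑ l, v i l * (y l - y' l)
        = ∑ l, v i l * ((V.starProjection y) l - (V.starProjection y') l) := by
      have h1 : inner ℝ (v i) (V.starProjection (y - y')) = inner ℝ (v i) (y - y') := by
        rw [← Submodule.inner_starProjection_left_eq_right,
          Submodule.starProjection_eq_self_iff.2 (hvV i)]
      rw [map_sub] at h1
      simpa [PiLp.inner_apply, mul_comm] using h1.symm
    have hcoord : ∀ l, |(V.starProjection y) l - (V.starProjection y') l| ≤ (R : ℝ)⁻¹ := by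
      intro l
      rw [← sideLength_eq]
      refine le_trans ?_ hdist
      rw [dist_eq_norm]
      exact PiLp.norm_apply_le (V.starProjection y - V.starProjection y') l
    have hpair2 : |∑ l, v i l * (y l - y' l)| ≤ d * (R : ℝ)⁻¹ := by
      rw [hpair]
      refine (Finset.abs_sum_le_sum_abs _ _).trans ?_
      calc _ ≤ ∑ _l : Fin d, (R : ℝ)⁻¹ := Finset.sum_le_sum fun l _ => by
            rw [abs_mul]
            exact (mul_le_of_le_one_left (abs_nonneg _) (hv1 i l)).trans (hcoord l)
        _ = _ := by simp
    have hidx : |∑ l, v i l * ((j l : ℝ) - j₀ l)| ≤ 3 * d := by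
      have hsplit : ∑ l, v i l * ((j l : ℝ) - j₀ l) = R * ∑ l, v i l * (y l - y' l)
          + ∑ l, v i l * ((j l - y l * R) - (j₀ l - y' l * R)) := by
        rw [Finset.mul_sum, ← Finset.sum_add_distrib]
        exact Finset.sum_congr rfl fun l _ => by ring
      have herr : |∑ l, v i l * ((j l - y l * R) - (j₀ l - y' l * R))| ≤ d := by
        refine (Finset.abs_sum_le_sum_abs _ _).trans ?_
        calc _ ≤ ∑ _l : Fin d, (1 : ℝ) := Finset.sum_le_sum fun l _ => by
              rw [abs_mul]
              refine (mul_le_of_le_one_left (abs_nonneg _) (hv1 i l)).trans ?_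
              rw [abs_le]
              constructor <;> linarith [(hy l).1, (hy l).2, (hy' l).1, (hy' l).2]
          _ = _ := by simp
      rw [hsplit]
      refine (abs_add_le _ _).trans ?_
      rw [abs_mul, abs_of_pos hR]
      have := mul_le_mul_of_nonneg_left hpair2 hR.le
      have h2 : (R : ℝ) * (d * (R : ℝ)⁻¹) = d := by field_simp
      have h3 : (0 : ℝ) ≤ d := by positivity
      linarith
    have hround : |∑ l, (T i l : ℝ) * ((j l : ℝ) - j₀ l)| ≤ 4 * d * R := by
      have hsplit : ∑ l, (T i l : ℝ) * ((j l : ℝ) - j₀ l)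
          = R * ∑ l, v i l * ((j l : ℝ) - j₀ l)
            + ∑ l, (T i l - v i l * R) * ((j l : ℝ) - j₀ l) := by
        rw [Finset.mul_sum, ← Finset.sum_add_distrib]
        exact Finset.sum_congr rfl fun l _ => by ring
      have herr : |∑ l, (T i l - v i l * R) * ((j l : ℝ) - j₀ l)| ≤ d * R := by
        refine (Finset.abs_sum_le_sum_abs _ _).trans ?_
        calc _ ≤ ∑ _l : Fin d, (R : ℝ) := Finset.sum_le_sum fun l _ => by
              rw [abs_mul]
              have h1 : |(T i l : ℝ) - v i l * R| ≤ 1 := by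
                rw [abs_le]
                have := Int.floor_le (v i l * R)
                have := Int.lt_floor_add_one (v i l * R)
                simp only [hT]
                constructor <;> linarith
              refine (mul_le_of_le_one_left (abs_nonneg _) h1).trans ?_
              have h2 : (j l : ℝ) ≤ R := by exact_mod_cast (hgrid j hj l).le
              have h3 : (j₀ l : ℝ) ≤ R := by exact_mod_cast (hgrid j₀ hj₀ l).le
              have h4 : (0 : ℝ) ≤ j l := by positivity
              have h5 : (0 : ℝ) ≤ j₀ l := by positivity
              rw [abs_le]
              constructor <;> linarith
          _ = _ := by simp
      rw [hsplit]
      refine (abs_add_le _ _).trans ?_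
      rw [abs_mul, abs_of_pos hR]
      nlinarith [mul_le_mul_of_nonneg_left hidx hR.le]
    exact_mod_cast hround

end slabs

/-! ### Exponential moments of weighted counts -/

section moments

open MeasureTheory ProbabilityTheory

variable {d : ℕ} {M N : ℕ → ℕ} {Ω : Type*} [MeasurableSpace Ω] {P : Measure Ω}
  {C : ℕ → Ω → Finset (Fin d → ℕ)}

namespace IsConstruction

theorem measurable (hC : IsConstruction M N P C) (n : ℕ) : Measurable[_, ⊤] (C n) := by
  intro S _
  have h : C n ⁻¹' S = ⋃ c ∈ S, {ω | C n ω = c} := by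
    ext ω; simp
  rw [h]
  exact MeasurableSet.biUnion (Set.to_countable S) fun c _ => hC.measurableSet_eq n c

theorem measurable_comp (hC : IsConstruction M N P C) (n : ℕ) {β : Type*} [MeasurableSpace β]
    (f : Finset (Fin d → ℕ) → β) : Measurable fun ω => f (C n ω) :=
  (measurable_from_top (f := f)).comp (hC.measurable n)

theorem mem_powerset (hC : IsConstruction M N P C) (hM : ∀ n, 2 ≤ M n) (n : ℕ) (ω : Ω) :
    C n ω ∈ (Fintype.piFinset fun _ : Fin d => Finset.range (gridSize M n)).powerset := by
  rw [Finset.mem_powerset]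
  intro j hj
  rw [Fintype.mem_piFinset]
  exact fun i => Finset.mem_range.2 ((hC.isTree ω).lt_gridSize hM hj i)

theorem integrable_comp (hC : IsConstruction M N P C) (hM : ∀ n, 2 ≤ M n) (n : ℕ)
    (f : Finset (Fin d → ℕ) → ℝ) (ν : Measure Ω) [IsFiniteMeasure ν] :
    Integrable (fun ω => f (C n ω)) ν := by
  refine Integrable.of_bound (hC.measurable_comp n f).aestronglyMeasurable
    (∑ c ∈ (Fintype.piFinset fun _ : Fin d => Finset.range (gridSize M n)).powerset, ‖f c‖)
    (Filter.Eventually.of_forall fun ω => ?_)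
  exact Finset.single_le_sum (f := fun c => ‖f c‖) (fun c _ => norm_nonneg _)
    (hC.mem_powerset hM n ω)

/-- Conditioning on the collection of generation `n`. -/
theorem integral_eq_sum (hC : IsConstruction M N P C) (hM : ∀ n, 2 ≤ M n) (n : ℕ)
    [IsFiniteMeasure P] {g : Ω → ℝ} (hg : Integrable g P) :
    ∫ ω, g ω ∂P
      = ∑ c ∈ (Fintype.piFinset fun _ : Fin d => Finset.range (gridSize M n)).powerset,
        P.real {ω | C n ω = c} * ∫ ω, g ω ∂(cond P {ω | C n ω = c}) := by
  have huniv : (⋃ c ∈ (Fintype.piFinset fun _ : Fin d =>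
      Finset.range (gridSize M n)).powerset, {ω | C n ω = c}) = Set.univ := by
    refine Set.eq_univ_of_forall fun ω => Set.mem_iUnion₂.2 ⟨C n ω, hC.mem_powerset hM n ω, rfl⟩
  rw [← setIntegral_univ, ← huniv, integral_biUnion_finset _
    (fun c _ => hC.measurableSet_eq n c) _ (fun c _ => hg.integrableOn)]
  · refine Finset.sum_congr rfl fun c _ => ?_
    rw [ProbabilityTheory.cond, integral_smul_measure, smul_eq_mul, ← mul_assoc]
    by_cases h0 : P {ω | C n ω = c} = 0
    · rw [Measure.restrict_eq_zero.2 h0]; simp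
    · rw [ENNReal.toReal_inv, Measure.real, mul_inv_cancel₀, one_mul]
      exact ENNReal.toReal_ne_zero.2 ⟨h0, measure_ne_top _ _⟩
  · intro c _ c' _ hne
    refine Set.disjoint_left.2 fun ω h h' => hne ?_
    exact h.symm.trans h'

/-- The conditional exponential moment of the total weight of the subcubes chosen inside one cube,
via `exp x ≤ 1 + x + x ^ 2` for `0 ≤ x ≤ 1`. -/
theorem mgf_children_le (hC : IsConstruction M N P C) (hM : ∀ n, 2 ≤ M n) [IsFiniteMeasure P]
    (n : ℕ) {c : Finset (Fin d → ℕ)} (hc : P {ω | C n ω = c} ≠ 0) {q : Fin d → ℕ} (hq : q ∈ c)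
    {w : (Fin d → ℕ) → ℝ} (hw : ∀ j, 0 ≤ w j) {θ W : ℝ} (hθ : 0 ≤ θ)
    (hW : ∑ j ∈ children (M n) q, w j ≤ W) (hθW : θ * W ≤ 1) :
    mgf (fun ω => ∑ j ∈ C (n + 1) ω ∩ children (M n) q, w j) (cond P {ω | C n ω = c}) θ
      ≤ Real.exp ((N n : ℝ) / (M n : ℝ) ^ d * θ * (1 + θ * W)
          * ∑ j ∈ children (M n) q, w j) := by
  have hprob : IsProbabilityMeasure (cond P {ω | C n ω = c}) := cond_isProbabilityMeasure hc
  set ν := cond P {ω | C n ω = c} with hν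
  set Y : Ω → ℝ := fun ω => ∑ j ∈ C (n + 1) ω ∩ children (M n) q, w j with hY
  have hYint : Integrable Y ν :=
    hC.integrable_comp hM (n + 1) (fun s => ∑ j ∈ s ∩ children (M n) q, w j) ν
  have hY0 : ∀ ω, 0 ≤ Y ω := fun ω => Finset.sum_nonneg fun j _ => hw j
  have hYW : ∀ ω, Y ω ≤ W := fun ω =>
    (Finset.sum_le_sum_of_subset_of_nonneg Finset.inter_subset_right fun j _ _ => hw j).trans hW
  have hEY : ∫ ω, Y ω ∂ν = (N n : ℝ) / (M n : ℝ) ^ d * ∑ j ∈ children (M n) q, w j := by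
    have hmeas : ∀ j, MeasurableSet {ω | j ∈ C (n + 1) ω} := fun j =>
      hC.measurable (n + 1) (show MeasurableSet[⊤] {s | j ∈ s} from trivial)
    have h1 : ∀ ω, Y ω
        = ∑ j ∈ children (M n) q, Set.indicator {ω | j ∈ C (n + 1) ω} (fun _ => w j) ω := by
      intro ω
      simp only [hY, Set.indicator_apply, Set.mem_ofPred_eq]
      rw [← Finset.sum_filter]
      refine Finset.sum_congr ?_ fun _ _ => rfl
      ext j; simp [and_comm]
    simp only [h1]
    rw [integral_finsetSum _ fun j _ => (integrable_const _).indicator (hmeas j), Finset.mul_sum]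
    refine Finset.sum_congr rfl fun j hj => ?_
    rw [integral_indicator_const _ (hmeas j), hC.prob_chosen n c hc q hq j hj, smul_eq_mul]
  calc mgf Y ν θ ≤ ∫ ω, (1 + θ * (1 + θ * W) * Y ω) ∂ν := by
        refine integral_mono
          (hC.integrable_comp hM (n + 1)
            (fun s => Real.exp (θ * ∑ j ∈ s ∩ children (M n) q, w j)) ν)
          ((integrable_const _).add (hYint.const_mul _)) fun ω => ?_
        have h0 : 0 ≤ θ * Y ω := mul_nonneg hθ (hY0 ω)
        have h1 : θ * Y ω ≤ θ * W := mul_le_mul_of_nonneg_left (hYW ω) hθ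
        have h2 := Real.abs_exp_sub_one_sub_id_le (x := θ * Y ω)
          (by rw [abs_of_nonneg h0]; exact h1.trans hθW)
        have h3 := (abs_le.1 h2).2
        have h4 : (θ * Y ω) ^ 2 ≤ θ * Y ω * (θ * W) := by
          rw [sq]; exact mul_le_mul_of_nonneg_left h1 h0
        simp only
        nlinarith
    _ = (N n : ℝ) / (M n : ℝ) ^ d * θ * (1 + θ * W) * ∑ j ∈ children (M n) q, w j + 1 := by
        rw [integral_add (integrable_const _) (hYint.const_mul _), integral_const_mul, hEY]
        simp
        ring
    _ ≤ _ := Real.add_one_le_exp _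

/-- One step of the recursion for exponential moments. -/
theorem integral_exp_succ_le (hC : IsConstruction M N P C) (hM : ∀ n, 2 ≤ M n)
    [IsFiniteMeasure P] (n : ℕ)
    {w : (Fin d → ℕ) → ℝ} (hw : ∀ j, 0 ≤ w j) {θ W : ℝ} (hθ : 0 ≤ θ)
    (hW : ∀ q, ∑ j ∈ children (M n) q, w j ≤ W) (hθW : θ * W ≤ 1) :
    ∫ ω, Real.exp (θ * ∑ j ∈ C (n + 1) ω, w j) ∂P
      ≤ ∫ ω, Real.exp ((N n : ℝ) / (M n : ℝ) ^ d * θ * (1 + θ * W)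
          * ∑ q ∈ C n ω, ∑ j ∈ children (M n) q, w j) ∂P := by
  rw [hC.integral_eq_sum hM n
      (hC.integrable_comp hM (n + 1) (fun s => Real.exp (θ * ∑ j ∈ s, w j)) P),
    hC.integral_eq_sum hM n
      (hC.integrable_comp hM n (fun s => Real.exp ((N n : ℝ) / (M n : ℝ) ^ d * θ * (1 + θ * W)
          * ∑ q ∈ s, ∑ j ∈ children (M n) q, w j)) P)]
  refine Finset.sum_le_sum fun c _ => ?_
  by_cases h0 : P {ω | C n ω = c} = 0
  · simp [Measure.real, h0]
  refine mul_le_mul_of_nonneg_left ?_ measureReal_nonneg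
  have hprob : IsProbabilityMeasure (cond P {ω | C n ω = c}) := cond_isProbabilityMeasure h0
  set ν := cond P {ω | C n ω = c} with hν
  have hae : ∀ᵐ ω ∂ν, C n ω = c :=
    ae_cond_of_forall_mem (hC.measurableSet_eq n c) fun ω h => h
  set X : {q // q ∈ c} → Ω → ℝ := fun q ω => ∑ j ∈ C (n + 1) ω ∩ children (M n) q.1, w j with hX
  have hind : iIndepFun X ν :=
    (hC.indep n c h0).comp (fun _ s => ∑ j ∈ s, w j) fun _ => measurable_from_top
  have hXmeas : ∀ q, Measurable (X q) := fun q =>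
    hC.measurable_comp (n + 1) fun s => ∑ j ∈ s ∩ children (M n) q.1, w j
  have hsplit : ∀ ω, C n ω = c → ∑ j ∈ C (n + 1) ω, w j = (∑ q, X q) ω := by
    intro ω hω
    have hmaps : ∀ j ∈ C (n + 1) ω, ancestor (M n) j ∈ c := fun j hj =>
      hω ▸ (hC.isTree ω).ancestor_mem_of_mem_succ hM hj
    rw [← Finset.sum_fiberwise_of_maps_to hmaps, Finset.sum_apply, ← Finset.sum_coe_sort c]
    refine Finset.sum_congr rfl fun q _ => Finset.sum_congr ?_ fun _ _ => rfl
    ext j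
    simp [mem_children (show 0 < M n by have := hM n; omega)]
  calc ∫ ω, Real.exp (θ * ∑ j ∈ C (n + 1) ω, w j) ∂ν
      = mgf (∑ q, X q) ν θ := by
        refine integral_congr_ae ?_
        filter_upwards [hae] with ω hω
        rw [hsplit ω hω]
    _ = ∏ q, mgf (X q) ν θ := hind.mgf_sum hXmeas _
    _ ≤ ∏ q : {q // q ∈ c}, Real.exp ((N n : ℝ) / (M n : ℝ) ^ d * θ * (1 + θ * W)
          * ∑ j ∈ children (M n) q.1, w j) :=
        Finset.prod_le_prod (fun q _ => mgf_nonneg) fun q _ =>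
          hC.mgf_children_le hM n h0 q.2 hw hθ (hW q.1) hθW
    _ = Real.exp ((N n : ℝ) / (M n : ℝ) ^ d * θ * (1 + θ * W)
          * ∑ q ∈ c, ∑ j ∈ children (M n) q, w j) := by
        rw [← Real.exp_sum, Finset.mul_sum,
          ← Finset.sum_coe_sort c]
    _ = _ := by
        have : ∀ᵐ ω ∂ν, Real.exp ((N n : ℝ) / (M n : ℝ) ^ d * θ * (1 + θ * W)
            * ∑ q ∈ C n ω, ∑ j ∈ children (M n) q, w j)
            = Real.exp ((N n : ℝ) / (M n : ℝ) ^ d * θ * (1 + θ * W)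
              * ∑ q ∈ c, ∑ j ∈ children (M n) q, w j) := by
          filter_upwards [hae] with ω hω
          rw [hω]
        rw [integral_congr_ae this]
        simp

end IsConstruction

/-- The number of cubes of generation `n` in `A` that lie in the cube `q` of generation `m`. -/
def countIn (M : ℕ → ℕ) (A : Finset (Fin d → ℕ)) (n m : ℕ) (q : Fin d → ℕ) : ℕ :=
  (A.filter fun j => ancestor (blockSize M m n) j = q).card

theorem sum_children_countIn (hM : ∀ n, 2 ≤ M n) (A : Finset (Fin d → ℕ)) {n m : ℕ} (h : m < n)
    (q : Fin d → ℕ) :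
    ∑ j ∈ children (M m) q, countIn M A n (m + 1) j = countIn M A n m q := by
  have hMm : 0 < M m := by have := hM m; omega
  rw [countIn, Finset.card_eq_sum_card_fiberwise (t := children (M m) q)
    (f := ancestor (blockSize M (m + 1) n))]
  · refine Finset.sum_congr rfl fun j hj => ?_
    rw [countIn, Finset.filter_filter]
    congr 1
    refine Finset.filter_congr fun i _ => ?_
    rw [mem_children hMm] at hj
    rw [blockSize_succ_left M h, ← ancestor_ancestor]
    constructor
    · rintro rfl
      exact ⟨hj, rfl⟩
    · exact fun h => h.2
  · intro j hj
    have hj2 := (Finset.mem_filter.1 (Finset.mem_coe.1 hj)).2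
    rw [blockSize_succ_left M h, ← ancestor_ancestor] at hj2
    exact Finset.mem_coe.2 ((mem_children hMm).2 hj2)

/-- Exponential moment of the number of chosen cubes in a fixed set `A` of cubes of generation `n`,
for any sequence of exponents satisfying the recursion. -/
theorem IsConstruction.integral_exp_card_inter_le (hC : IsConstruction M N P C)
    (hM : ∀ n, 2 ≤ M n) [IsProbabilityMeasure P] {n : ℕ} (hn : 0 < n)
    (A : Finset (Fin d → ℕ)) (θ W : ℕ → ℝ)
    (hθ : ∀ m, 0 ≤ θ m) (hW : ∀ m < n, ∀ q, (countIn M A n m q : ℝ) ≤ W m)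
    (hθW : ∀ m < n, θ (m + 1) * W m ≤ 1)
    (hrec : ∀ m < n, (N m : ℝ) / (M m : ℝ) ^ d * θ (m + 1) * (1 + θ (m + 1) * W m) ≤ θ m) :
    ∫ ω, Real.exp (θ n * ((C n ω ∩ A).card : ℝ)) ∂P ≤ Real.exp (θ 0 * W 0) := by
  have key : ∀ m ≤ n, ∫ ω, Real.exp (θ m * ∑ j ∈ C m ω, (countIn M A n m j : ℝ)) ∂P
      ≤ Real.exp (θ 0 * W 0) := by
    intro m
    induction m with
    | zero =>
      intro _
      simp only [hC.zero, Finset.sum_singleton, integral_const, probReal_univ, one_smul]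
      refine Real.exp_le_exp.2 (mul_le_mul_of_nonneg_left ?_ (hθ 0))
      exact hW 0 hn 0
    | succ m ih =>
      intro hm
      refine le_trans ?_ (ih (by omega))
      have hsum : ∀ q, ∑ j ∈ children (M m) q, (countIn M A n (m + 1) j : ℝ)
          = countIn M A n m q := fun q => by
        exact_mod_cast sum_children_countIn hM A (by omega) q
      refine (hC.integral_exp_succ_le hM m (fun j => Nat.cast_nonneg _) (hθ (m + 1))
        (fun q => (hsum q).trans_le (hW m (by omega) q)) (hθW m (by omega))).trans ?_
      simp only [hsum]
      refine integral_mono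
        (hC.integrable_comp hM m (fun s => Real.exp ((N m : ℝ) / (M m : ℝ) ^ d * θ (m + 1)
          * (1 + θ (m + 1) * W m) * ∑ j ∈ s, (countIn M A n m j : ℝ))) P)
        (hC.integrable_comp hM m
          (fun s => Real.exp (θ m * ∑ j ∈ s, (countIn M A n m j : ℝ))) P) fun ω => ?_
      exact Real.exp_le_exp.2 (mul_le_mul_of_nonneg_right (hrec m (by omega))
        (Finset.sum_nonneg fun j _ => Nat.cast_nonneg _))
  refine le_of_eq_of_le ?_ (key n le_rfl)
  refine integral_congr_ae (Filter.Eventually.of_forall fun ω => ?_)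
  have hcount : ∀ j, countIn M A n n j = if j ∈ A then 1 else 0 := by
    intro j
    simp only [countIn, blockSize_self, ancestor_one, Finset.filter_eq']
    split_ifs <;> simp
  simp only [hcount]
  congr 2
  rw [← Finset.filter_mem_eq_inter, Finset.card_filter]
  norm_cast

end moments

/-! ### No slab contains too many chosen cubes -/

section tail

open MeasureTheory ProbabilityTheory Filter

variable {d k : ℕ} {M N : ℕ → ℕ} {Ω : Type*} [MeasurableSpace Ω] {P : Measure Ω}
  [IsProbabilityMeasure P] {C : ℕ → Ω → Finset (Fin d → ℕ)}

theorem one_add_inv_pow_le_exp {n i : ℕ} (hn : 0 < n) (hi : i ≤ n) :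
    (1 + (n : ℝ)⁻¹) ^ i ≤ Real.exp 1 := by
  have hn' : (0 : ℝ) < n := by exact_mod_cast hn
  calc (1 + (n : ℝ)⁻¹) ^ i ≤ (1 + (n : ℝ)⁻¹) ^ n :=
        pow_le_pow_right₀ (by simp) hi
    _ ≤ Real.exp (n : ℝ)⁻¹ ^ n :=
        pow_le_pow_left₀ (by positivity) (by rw [add_comm]; exact Real.add_one_le_exp _) n
    _ = Real.exp 1 := by rw [← Real.exp_nat_mul, mul_inv_cancel₀ hn'.ne']

/-- The number of chosen cubes in a slab exceeds `P_n r_n ^ t` by more than a polynomial factor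
only with exponentially small probability. The exponents
`θ m = θ (P_n / P_m) (r_n / r_m) ^ d (1 + 1 / n) ^ (n - m)` satisfy the recursion for exponential
moments because `t ≤ k` and the slab has `O((r_m / r_n) ^ (d - k))` cubes in each cube of
generation `m`. -/
theorem IsConstruction.measureReal_card_inter_slab_le (hC : IsConstruction M N P C)
    (hM : ∀ n, 2 ≤ M n) {B : ℕ} (hB : ∀ n, M n ≤ B) (hN : ∀ n, 1 ≤ N n) {t a : ℝ} (htk : t ≤ k)
    (ha : 0 < a) (hP : ∀ n, a * (gridSize M n : ℝ) ^ t ≤ cubeCount N n)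
    {n : ℕ} (hn : 0 < n) {A : Finset (Fin d → ℕ)} (hA : A ∈ slabs d k (gridSize M n)) (x : ℝ) :
    P.real {ω | x * n ^ 2 * (Real.exp 1 * (8 * d + 1) ^ k * B ^ d / a)
        * (cubeCount N n / (gridSize M n : ℝ) ^ t) ≤ ((C n ω ∩ A).card : ℝ)}
      ≤ Real.exp (1 - x * n) := by
  have hn' : (0 : ℝ) < n := by exact_mod_cast hn
  have hR : ∀ m, (1 : ℝ) ≤ gridSize M m := fun m => by exact_mod_cast gridSize_pos hM m
  have hRt : ∀ m, (0 : ℝ) < (gridSize M m : ℝ) ^ t := fun m =>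
    Real.rpow_pos_of_pos (by linarith [hR m]) t
  have hPpos : ∀ m, (0 : ℝ) < cubeCount N m := fun m => by exact_mod_cast cubeCount_pos hN m
  have hL : ∀ m, (1 : ℝ) ≤ blockSize M m n := fun m => by exact_mod_cast blockSize_pos hM m n
  have hL0 : ∀ m, (0 : ℝ) < blockSize M m n := fun m => by linarith [hL m]
  have hB1 : (1 : ℝ) ≤ B := by
    have := hM 0
    have := hB 0
    exact_mod_cast (show 1 ≤ B by omega)
  have ha1 : a ≤ 1 := by simpa [cubeCount] using hP 0
  set K : ℝ := (8 * d + 1) ^ k with hK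
  have hK0 : 0 < K := by positivity
  set D : ℝ := Real.exp 1 * K * B ^ d / a with hD
  have hD0 : 0 < D := by positivity
  set Q : ℝ := cubeCount N n / (gridSize M n : ℝ) ^ t with hQ
  have hQ0 : 0 < Q := div_pos (hPpos n) (hRt n)
  set η : ℝ := (n * D * Q)⁻¹ with hη
  have hη0 : 0 < η := by positivity
  have hηDQ : η * (D * Q) = (n : ℝ)⁻¹ := by rw [hη]; field_simp
  set b : ℕ → ℝ := fun m => cubeCount N n / (cubeCount N m * (blockSize M m n : ℝ) ^ d) with hb
  have hb0 : ∀ m, 0 < b m := fun m =>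
    div_pos (hPpos n) (mul_pos (hPpos m) (pow_pos (hL0 m) d))
  set θ : ℕ → ℝ := fun m => η * b m * (1 + (n : ℝ)⁻¹) ^ (n - m) with hθdef
  set W : ℕ → ℝ := fun m => K * (blockSize M m n : ℝ) ^ d / (blockSize M m n : ℝ) ^ k with hWdef
  have hθ0 : ∀ m, 0 ≤ θ m := fun m => by have := hb0 m; positivity
  have hθle : ∀ m, θ m ≤ η * b m * Real.exp 1 := fun m =>
    mul_le_mul_of_nonneg_left (one_add_inv_pow_le_exp hn (Nat.sub_le n m))
      (by have := hb0 m; positivity)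
  have hW0 : ∀ m, 0 ≤ W m := fun m => by have := hL0 m; positivity
  have hW : ∀ m < n, ∀ q, (countIn M A n m q : ℝ) ≤ W m := by
    intro m _ q
    rw [hWdef, le_div_iff₀ (pow_pos (hL0 m) k)]
    have h : countIn M A n m q * blockSize M m n ^ k ≤ (8 * d + 1) ^ k * blockSize M m n ^ d :=
      card_filter_ancestor_le_of_mem_slabs (gridSize_pos hM n) (blockSize_pos hM m n) hA q
    rw [hK]
    exact_mod_cast h
  have hθW : ∀ m < n, θ (m + 1) * W m ≤ (n : ℝ)⁻¹ := by
    intro m hm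
    have hLm : (blockSize M m n : ℝ) = M m * blockSize M (m + 1) n := by
      exact_mod_cast blockSize_succ_left M hm
    have hMm : (0 : ℝ) < M m := by
      have := hM m; exact_mod_cast (show 0 < M m by omega)
    have hMB : (M m : ℝ) ≤ B := by exact_mod_cast hB m
    have hM1 : (1 : ℝ) ≤ M m := by
      have := hM m; exact_mod_cast (show 1 ≤ M m by omega)
    have hl := hL (m + 1)
    have hl0 := hL0 (m + 1)
    have hgrow : (gridSize M n : ℝ) ^ t
        ≤ (gridSize M (m + 1) : ℝ) ^ t * (blockSize M m n : ℝ) ^ k := by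
      have h1 : (gridSize M n : ℝ) = gridSize M (m + 1) * blockSize M (m + 1) n := by
        exact_mod_cast (gridSize_mul_blockSize M (show m + 1 ≤ n by omega)).symm
      rw [h1, Real.mul_rpow (by positivity) (by positivity)]
      refine mul_le_mul_of_nonneg_left ?_ (hRt _).le
      calc (blockSize M (m + 1) n : ℝ) ^ t ≤ (blockSize M (m + 1) n : ℝ) ^ (k : ℝ) :=
            Real.rpow_le_rpow_of_exponent_le hl htk
        _ = (blockSize M (m + 1) n : ℝ) ^ k := Real.rpow_natCast _ _
        _ ≤ _ := by
            rw [hLm]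
            exact pow_le_pow_left₀ hl0.le (le_mul_of_one_le_left hl0.le hM1) k
    have hbW : b (m + 1) * W m ≤ K * B ^ d / a * Q := by
      have h1 : b (m + 1) * W m = K * M m ^ d * (cubeCount N n
          / (cubeCount N (m + 1) * (blockSize M m n : ℝ) ^ k)) := by
        have := (hPpos (m + 1)).ne'
        have := (hL0 m).ne'
        simp only [hb, hWdef]
        rw [show (blockSize M m n : ℝ) ^ d = M m ^ d * (blockSize M (m + 1) n : ℝ) ^ d by
          rw [hLm, mul_pow]]
        field_simp
      have h2 : (cubeCount N n : ℝ) / (cubeCount N (m + 1) * (blockSize M m n : ℝ) ^ k)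
          ≤ a⁻¹ * Q := by
        rw [hQ, ← div_eq_inv_mul, div_div]
        refine div_le_div_of_nonneg_left (hPpos n).le (mul_pos (hRt n) ha) ?_
        calc (gridSize M n : ℝ) ^ t * a
            ≤ (gridSize M (m + 1) : ℝ) ^ t * (blockSize M m n : ℝ) ^ k * a :=
              mul_le_mul_of_nonneg_right hgrow ha.le
          _ = a * (gridSize M (m + 1) : ℝ) ^ t * (blockSize M m n : ℝ) ^ k := by ring
          _ ≤ _ := mul_le_mul_of_nonneg_right (hP (m + 1)) (pow_nonneg (hL0 m).le k)
      rw [h1]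
      calc K * (M m : ℝ) ^ d * (cubeCount N n
            / (cubeCount N (m + 1) * (blockSize M m n : ℝ) ^ k))
          ≤ K * B ^ d * (a⁻¹ * Q) :=
            mul_le_mul (mul_le_mul_of_nonneg_left (pow_le_pow_left₀ hMm.le hMB d) hK0.le) h2
              (div_nonneg (hPpos n).le (mul_nonneg (hPpos _).le (pow_nonneg (hL0 m).le k)))
              (by positivity)
        _ = _ := by ring
    calc θ (m + 1) * W m ≤ η * b (m + 1) * Real.exp 1 * W m :=
          mul_le_mul_of_nonneg_right (hθle _) (hW0 m)
      _ = η * Real.exp 1 * (b (m + 1) * W m) := by ring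
      _ ≤ η * Real.exp 1 * (K * B ^ d / a * Q) := mul_le_mul_of_nonneg_left hbW (by positivity)
      _ = η * (D * Q) := by rw [hD]; ring
      _ = _ := hηDQ
  have hrec : ∀ m < n,
      (N m : ℝ) / (M m : ℝ) ^ d * θ (m + 1) * (1 + θ (m + 1) * W m) ≤ θ m := by
    intro m hm
    have hstep : (N m : ℝ) / (M m : ℝ) ^ d * b (m + 1) = b m := by
      have hLm : (blockSize M m n : ℝ) = M m * blockSize M (m + 1) n := by
        exact_mod_cast blockSize_succ_left M hm
      have hPm : (cubeCount N (m + 1) : ℝ) = cubeCount N m * N m := by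
        exact_mod_cast cubeCount_succ N m
      have h1 : (N m : ℝ) ≠ 0 := by
        have := hN m; exact_mod_cast (show N m ≠ 0 by omega)
      have h2 : (M m : ℝ) ≠ 0 := by
        have := hM m; exact_mod_cast (show M m ≠ 0 by omega)
      have h3 := (hPpos m).ne'
      have h4 := (hL0 (m + 1)).ne'
      simp only [hb]
      rw [hLm, hPm, mul_pow]
      field_simp
    have hpow : (1 + (n : ℝ)⁻¹) ^ (n - m)
        = (1 + (n : ℝ)⁻¹) ^ (n - (m + 1)) * (1 + (n : ℝ)⁻¹) := by
      rw [← pow_succ]; congr 1; omega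
    calc (N m : ℝ) / (M m : ℝ) ^ d * θ (m + 1) * (1 + θ (m + 1) * W m)
        ≤ (N m : ℝ) / (M m : ℝ) ^ d * θ (m + 1) * (1 + (n : ℝ)⁻¹) := by
          refine mul_le_mul_of_nonneg_left ?_ (mul_nonneg (by positivity) (hθ0 _))
          linarith [hθW m hm]
      _ = η * ((N m : ℝ) / (M m : ℝ) ^ d * b (m + 1))
          * ((1 + (n : ℝ)⁻¹) ^ (n - (m + 1)) * (1 + (n : ℝ)⁻¹)) := by
          simp only [hθdef]; ring
      _ = θ m := by rw [hstep, ← hpow]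
  have hninv : (n : ℝ)⁻¹ ≤ 1 := inv_le_one_of_one_le₀ (by exact_mod_cast hn)
  have hexp := hC.integral_exp_card_inter_le hM hn A θ W hθ0 hW
    (fun m hm => (hθW m hm).trans hninv) hrec
  have hstart : θ 0 * W 0 ≤ 1 := by
    have hbW : b 0 * W 0 ≤ K * Q := by
      have h1 : b 0 * W 0 = K * (cubeCount N n / (blockSize M 0 n : ℝ) ^ k) := by
        have := (hL0 0).ne'
        simp only [hb, hWdef, cubeCount, Finset.range_zero, Finset.prod_empty]
        field_simp
        simp
      rw [h1, hQ, blockSize_zero]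
      refine mul_le_mul_of_nonneg_left ?_ hK0.le
      refine div_le_div_of_nonneg_left (hPpos n).le (hRt n) ?_
      rw [← Real.rpow_natCast]
      exact Real.rpow_le_rpow_of_exponent_le (hR n) htk
    have hKD : Real.exp 1 * K ≤ D := by
      rw [hD, le_div_iff₀ ha]
      calc Real.exp 1 * K * a ≤ Real.exp 1 * K * 1 :=
            mul_le_mul_of_nonneg_left ha1 (by positivity)
        _ ≤ _ := mul_le_mul_of_nonneg_left (one_le_pow₀ hB1) (by positivity)
    calc θ 0 * W 0 ≤ η * b 0 * Real.exp 1 * W 0 := mul_le_mul_of_nonneg_right (hθle _) (hW0 0)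
      _ = η * Real.exp 1 * (b 0 * W 0) := by ring
      _ ≤ η * Real.exp 1 * (K * Q) := mul_le_mul_of_nonneg_left hbW (by positivity)
      _ = η * (Real.exp 1 * K * Q) := by ring
      _ ≤ η * (D * Q) :=
          mul_le_mul_of_nonneg_left (mul_le_mul_of_nonneg_right hKD hQ0.le) hη0.le
      _ = (n : ℝ)⁻¹ := hηDQ
      _ ≤ 1 := hninv
  have hθn : θ n = η := by
    have := (hPpos n).ne'
    simp [hθdef, hb, this]
  rw [hθn] at hexp
  refine (measure_ge_le_exp_mul_mgf (X := fun ω => ((C n ω ∩ A).card : ℝ)) _ hη0.le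
    (hC.integrable_comp hM n (fun s => Real.exp (η * ((s ∩ A).card : ℝ))) P)).trans ?_
  calc _ ≤ Real.exp (-η * (x * n ^ 2 * D * Q)) * Real.exp 1 :=
        mul_le_mul_of_nonneg_left (hexp.trans (Real.exp_le_exp.2 hstart)) (Real.exp_pos _).le
    _ = Real.exp (1 - x * n) := by
        rw [← Real.exp_add]
        congr 1
        have : -η * (x * n ^ 2 * D * Q) = -(x * n ^ 2) * (η * (D * Q)) := by ring
        rw [this, hηDQ]
        field_simp
        ring

/-- Almost surely, all slabs of late generations contain few chosen cubes: there are only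
exponentially many slabs, so the tail bounds are summable. -/
theorem IsConstruction.ae_eventually_card_inter_slab_lt (hC : IsConstruction M N P C)
    (hM : ∀ n, 2 ≤ M n) {B : ℕ} (hB : ∀ n, M n ≤ B) (hN : ∀ n, 1 ≤ N n) {t : ℝ} (ht0 : 0 ≤ t)
    (htk : t ≤ k) (ht : t < dimension M N) :
    ∃ D : ℝ, 0 < D ∧ ∀ᵐ ω ∂P, ∀ᶠ n : ℕ in atTop, ∀ A ∈ slabs d k (gridSize M n),
      ((C n ω ∩ A).card : ℝ) < D * n ^ 2 * (cubeCount N n / (gridSize M n : ℝ) ^ t) := by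
  obtain ⟨a, ha, hP⟩ := exists_mul_rpow_le_cubeCount hM hN ht0 ht
  have hB1 : (1 : ℝ) ≤ B := by
    have := hM 0
    have := hB 0
    exact_mod_cast (show 1 ≤ B by omega)
  set x : ℝ := (d * k + d : ℕ) * Real.log (3 * B) + 1 with hx
  have hx0 : 0 < x := by
    have : 0 ≤ Real.log (3 * B) := Real.log_nonneg (by linarith)
    positivity
  set D : ℝ := Real.exp 1 * (8 * d + 1) ^ k * B ^ d / a with hD
  refine ⟨x * D, by positivity, ?_⟩
  set bad : ℕ → Set Ω := fun n => ⋃ A ∈ slabs d k (gridSize M n),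
    {ω | x * n ^ 2 * D * (cubeCount N n / (gridSize M n : ℝ) ^ t) ≤ ((C n ω ∩ A).card : ℝ)}
    with hbad
  have hbound : ∀ n, P.real (bad n) ≤ Real.exp 1 * Real.exp (-n) := by
    intro n
    rcases Nat.eq_zero_or_pos n with rfl | hn
    · refine measureReal_le_one.trans ?_
      simp
    calc P.real (bad n) ≤ ∑ A ∈ slabs d k (gridSize M n), P.real {ω | x * n ^ 2 * D
            * (cubeCount N n / (gridSize M n : ℝ) ^ t) ≤ ((C n ω ∩ A).card : ℝ)} :=
          measureReal_biUnion_finset_le _ _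
      _ ≤ ∑ _A ∈ slabs d k (gridSize M n), Real.exp (1 - x * n) :=
          Finset.sum_le_sum fun A hA =>
            hC.measureReal_card_inter_slab_le hM hB hN htk ha hP hn hA x
      _ = (slabs d k (gridSize M n)).card * Real.exp (1 - x * n) := by
          rw [Finset.sum_const, nsmul_eq_mul]
      _ ≤ Real.exp (n * ((d * k + d : ℕ) * Real.log (3 * B))) * Real.exp (1 - x * n) := by
          refine mul_le_mul_of_nonneg_right ?_ (Real.exp_pos _).le
          have h1 : 3 * gridSize M n ≤ (3 * B) ^ n := by
            rw [mul_pow]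
            exact Nat.mul_le_mul (Nat.le_self_pow hn.ne' 3) (gridSize_le_pow hB n)
          have h2 : (slabs d k (gridSize M n)).card ≤ ((3 * B) ^ n) ^ (d * k + d) :=
            (card_slabs_le (gridSize_pos hM n)).trans (Nat.pow_le_pow_left h1 _)
          have h3 : Real.exp (n * ((d * k + d : ℕ) * Real.log (3 * B)))
              = ((3 * B : ℝ) ^ n) ^ (d * k + d) := by
            rw [Real.exp_nat_mul, Real.exp_nat_mul, Real.exp_log (by linarith), pow_right_comm]
          rw [h3]
          exact_mod_cast h2
      _ = Real.exp 1 * Real.exp (-n) := by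
          rw [← Real.exp_add, ← Real.exp_add, hx]
          congr 1
          ring
  have hsum : ∑' n, P (bad n) ≠ ⊤ := by
    have hs : Summable fun n : ℕ => Real.exp 1 * Real.exp (-n) :=
      Real.summable_exp_neg_nat.mul_left _
    refine ne_top_of_le_ne_top hs.tsum_ofReal_ne_top (ENNReal.tsum_le_tsum fun n => ?_)
    rw [← ofReal_measureReal (measure_ne_top P (bad n))]
    exact ENNReal.ofReal_le_ofReal (hbound n)
  filter_upwards [ae_eventually_notMem hsum] with ω hω
  filter_upwards [hω] with n hn A hA
  by_contra! hcon
  refine hn (Set.mem_iUnion₂.2 ⟨A, hA, le_trans (le_of_eq ?_) hcon⟩)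
  ring

/-- Almost surely, a slab of a late generation `n` carries at most the proportion `r_n ^ u` of the
chosen cubes, where `u < s ≤ k`. -/
theorem IsConstruction.ae_eventually_card_inter_slab_mul_le (hC : IsConstruction M N P C)
    (hM : ∀ n, 2 ≤ M n) {B : ℕ} (hB : ∀ n, M n ≤ B) (hN : ∀ n, 1 ≤ N n) {u : ℝ} (hu0 : 0 ≤ u)
    (hu : u < dimension M N) (hs : dimension M N ≤ k) :
    ∀ᵐ ω ∂P, ∀ᶠ n : ℕ in atTop, ∀ A ∈ slabs d k (gridSize M n),
      ((C n ω ∩ A).card : ℝ) * (gridSize M n : ℝ) ^ u ≤ cubeCount N n := by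
  obtain ⟨t, hut, ht⟩ := exists_between hu
  obtain ⟨D, hD, hae⟩ := hC.ae_eventually_card_inter_slab_lt (k := k) hM hB hN (hu0.trans hut.le)
    (ht.le.trans hs) ht
  have hpoly : ∀ᶠ n : ℕ in atTop, D * (n : ℝ) ^ 2 ≤ ((2 : ℝ) ^ (t - u)) ^ n := by
    have h2 : 1 < (2 : ℝ) ^ (t - u) := Real.one_lt_rpow (by norm_num) (by linarith)
    have hlim := tendsto_pow_const_div_const_pow_of_one_lt 2 h2
    filter_upwards [hlim.eventually_le_const (inv_pos.2 hD)] with n hn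
    rw [div_le_iff₀ (by positivity), ← div_eq_inv_mul, le_div_iff₀ hD] at hn
    linarith
  filter_upwards [hae] with ω hω
  filter_upwards [hω, hpoly] with n hn hpn A hA
  have hR : (0 : ℝ) < gridSize M n := by exact_mod_cast gridSize_pos hM n
  have hP : (0 : ℝ) ≤ cubeCount N n := by positivity
  have hle : D * (n : ℝ) ^ 2 ≤ (gridSize M n : ℝ) ^ (t - u) := by
    refine hpn.trans ?_
    rw [← Real.rpow_mul_natCast (by norm_num), mul_comm, Real.rpow_natCast_mul (by norm_num)]
    exact Real.rpow_le_rpow (by positivity) (by exact_mod_cast two_pow_le_gridSize hM n)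
      (by linarith)
  calc ((C n ω ∩ A).card : ℝ) * (gridSize M n : ℝ) ^ u
      ≤ D * n ^ 2 * (cubeCount N n / (gridSize M n : ℝ) ^ t) * (gridSize M n : ℝ) ^ u :=
        mul_le_mul_of_nonneg_right (hn A hA).le (by positivity)
    _ ≤ (gridSize M n : ℝ) ^ (t - u) * (cubeCount N n / (gridSize M n : ℝ) ^ t)
        * (gridSize M n : ℝ) ^ u := by gcongr
    _ = cubeCount N n := by
        rw [Real.rpow_sub hR]
        field_simp

end tail

/-! ### Mass distribution -/

section hausdorff

open MeasureTheory Filter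
open scoped ENNReal Topology

/-- For a compact set, a lower bound for the sums over finite covers by small open sets gives a
lower bound for the Hausdorff measure: enlarge the sets of an arbitrary countable cover to open
sets. -/
theorem hausdorffMeasure_ne_zero_of_finite_covers {X : Type*} [MetricSpace X] [MeasurableSpace X]
    [BorelSpace X] {K : Set X} (hK : IsCompact K) {u r c : ℝ} (hu : 0 < u) (hr : 0 < r)
    (hc : 0 < c)
    (h : ∀ (s : Finset ℕ) (O : ℕ → Set X) (ρ : ℕ → ℝ), (∀ i, IsOpen (O i)) →
      (∀ i, 0 < ρ i ∧ ρ i ≤ r) → (∀ i, ∀ x ∈ O i, ∀ y ∈ O i, dist x y ≤ ρ i) →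
      K ⊆ ⋃ i ∈ s, O i → c ≤ ∑ i ∈ s, ρ i ^ u) :
    μH[u] K ≠ 0 := by
  have hle : ENNReal.ofReal (c / 2) ≤ μH[u] K := by
    rw [Measure.hausdorffMeasure_apply]
    refine le_iSup₂_of_le (ENNReal.ofReal (r / 2)) (ENNReal.ofReal_pos.2 (by linarith)) ?_
    refine le_iInf₂ fun t ht => le_iInf fun hdiam => ?_
    have hfin : ∀ i, Metric.ediam (t i) ≠ ⊤ := fun i =>
      ne_top_of_le_ne_top ENNReal.ofReal_ne_top (hdiam i)
    set D : ℕ → ℝ := fun i => (Metric.ediam (t i)).toReal with hDdef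
    have hD0 : ∀ i, 0 ≤ D i := fun i => ENNReal.toReal_nonneg
    have hDr : ∀ i, D i ≤ r / 2 := fun i =>
      ENNReal.toReal_le_of_le_ofReal (by linarith) (hdiam i)
    have hδ : ∀ i, ∃ δ : ℝ, 0 < δ ∧ 2 * δ ≤ r / 2
        ∧ (D i + 2 * δ) ^ u ≤ D i ^ u + c / 2 / 2 / 2 ^ i := by
      intro i
      have hcont : ContinuousAt (fun δ : ℝ => (D i + 2 * δ) ^ u) 0 :=
        ContinuousAt.rpow_const (by fun_prop) (Or.inr hu.le)
      have h1 : ∀ᶠ δ : ℝ in 𝓝[>] 0, (D i + 2 * δ) ^ u ≤ D i ^ u + c / 2 / 2 / 2 ^ i := by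
        refine nhdsWithin_le_nhds (hcont.eventually_le_const ?_)
        simp only [mul_zero, add_zero]
        have : 0 < c / 2 / 2 / 2 ^ i := by positivity
        linarith
      have h2 : ∀ᶠ δ : ℝ in 𝓝[>] 0, δ ≤ r / 4 :=
        nhdsWithin_le_nhds (eventually_le_nhds (by linarith))
      obtain ⟨δ, h3, h4, h5⟩ := (h1.and (h2.and self_mem_nhdsWithin)).exists
      exact ⟨δ, h5, by linarith, h3⟩
    choose δ hδ0 hδr hδu using hδ
    obtain ⟨s, hs⟩ := hK.elim_finite_subcover (fun i => Metric.thickening (δ i) (t i))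
      (fun i => Metric.isOpen_thickening)
      (ht.trans (Set.iUnion_mono fun i => Metric.self_subset_thickening (hδ0 i) _))
    have hsum := h s (fun i => Metric.thickening (δ i) (t i)) (fun i => D i + 2 * δ i)
      (fun i => Metric.isOpen_thickening)
      (fun i => ⟨by linarith [hD0 i, hδ0 i], by linarith [hDr i, hδr i]⟩) (fun i x hx y hy => by
        obtain ⟨x', hx', hxx'⟩ := Metric.mem_thickening_iff.1 hx
        obtain ⟨y', hy', hyy'⟩ := Metric.mem_thickening_iff.1 hy
        have hd : dist x' y' ≤ D i := by
          rw [dist_edist]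
          exact ENNReal.toReal_mono (hfin i) (Metric.edist_le_ediam_of_mem hx' hy')
        have h1 := dist_triangle4 x x' y' y
        rw [dist_comm y' y] at h1
        linarith) hs
    have hgeom : ∑ i ∈ s, c / 2 / 2 / 2 ^ i ≤ c / 2 := by
      refine le_of_le_of_eq ?_ (tsum_geometric_two' (c / 2))
      exact (summable_geometric_two' (c / 2)).sum_le_tsum s fun i _ => by positivity
    have hDsum : c / 2 ≤ ∑ i ∈ s, D i ^ u := by
      have := hsum.trans (Finset.sum_le_sum fun i _ => hδu i)
      rw [Finset.sum_add_distrib] at this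
      linarith
    calc ENNReal.ofReal (c / 2) ≤ ENNReal.ofReal (∑ i ∈ s, D i ^ u) :=
          ENNReal.ofReal_le_ofReal hDsum
      _ = ∑ i ∈ s, Metric.ediam (t i) ^ u := by
          rw [ENNReal.ofReal_sum_of_nonneg fun i _ => Real.rpow_nonneg (hD0 i) u]
          refine Finset.sum_congr rfl fun i _ => ?_
          rw [← ENNReal.ofReal_rpow_of_nonneg (hD0 i) hu.le, ENNReal.ofReal_toReal (hfin i)]
      _ ≤ ∑' i, Metric.ediam (t i) ^ u := ENNReal.sum_le_tsum s
      _ ≤ _ := by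
          refine ENNReal.tsum_le_tsum fun i => ?_
          rcases (t i).eq_empty_or_nonempty with h0 | h0
          · simp [h0, hu]
          · exact le_iSup_of_le h0 le_rfl
  exact ((ENNReal.ofReal_pos.2 (by linarith)).trans_le hle).ne'

variable {d k : ℕ} {M N : ℕ → ℕ} {Ω : Type*} {C : ℕ → Ω → Finset (Fin d → ℕ)} {ω : Ω}

/-- Every scale `ρ` lies between the side lengths of two consecutive generations. -/
theorem exists_sideLength_lt_le (hM : ∀ n, 2 ≤ M n) {n₀ : ℕ} {ρ : ℝ} (hρ : 0 < ρ)
    (hρn : ρ ≤ sideLength M n₀) :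
    ∃ n, n₀ ≤ n ∧ sideLength M (n + 1) < ρ ∧ ρ ≤ sideLength M n := by
  have hex : ∃ n, sideLength M n < ρ := by
    obtain ⟨n, hn⟩ := exists_pow_lt_of_lt_one hρ (show (2 : ℝ)⁻¹ < 1 by norm_num)
    refine ⟨n, lt_of_le_of_lt ?_ hn⟩
    rw [sideLength_eq, inv_pow]
    exact inv_anti₀ (by positivity) (by exact_mod_cast two_pow_le_gridSize hM n)
  classical
  have hlt : n₀ < Nat.find hex := by
    by_contra! hle
    have h1 := Nat.find_spec hex
    have h2 : sideLength M n₀ ≤ sideLength M (Nat.find hex) := by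
      rw [sideLength_eq, sideLength_eq]
      exact inv_anti₀ (by exact_mod_cast gridSize_pos hM _)
        (by exact_mod_cast gridSize_mono hM hle)
    linarith
  obtain ⟨n, hn⟩ : ∃ n, Nat.find hex = n + 1 := Nat.exists_eq_succ_of_ne_zero (by omega)
  refine ⟨n, by omega, hn ▸ Nat.find_spec hex, ?_⟩
  exact not_lt.1 (Nat.find_min hex (by omega))

/-- If no slab carries more than the proportion `r_n ^ u` of the chosen cubes of generation `n`,
then the projection of the limit set has positive `u`-dimensional Hausdorff measure:
a set of diameter `ρ`, with `r_{n+1} < ρ ≤ r_n`, pulls back into one slab of generation `n`, and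
this bounds the proportion of chosen cubes of any later generation that it can account for. -/
theorem le_dimH_image_starProjection (hc : IsTree M N (fun n => C n ω)) (hM : ∀ n, 2 ≤ M n)
    {B : ℕ} (hB : ∀ n, M n ≤ B) (hN : ∀ n, 1 ≤ N n) {u : ℝ} (hu : 0 < u) {n₀ : ℕ}
    (hslab : ∀ n ≥ n₀, ∀ A ∈ slabs d k (gridSize M n),
      ((C n ω ∩ A).card : ℝ) * (gridSize M n : ℝ) ^ u ≤ cubeCount N n)
    (V : Submodule ℝ (EuclideanSpace ℝ (Fin d))) (hV : Module.finrank ℝ V = k) :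
    ENNReal.ofReal u ≤ dimH (V.starProjection '' limitSet M C ω) := by
  have hB0 : (0 : ℝ) < B := by
    have := hM 0
    have := hB 0
    exact_mod_cast (show 0 < B by omega)
  have hR : ∀ n, (0 : ℝ) < gridSize M n := fun n => by exact_mod_cast gridSize_pos hM n
  have hP : ∀ n, (0 : ℝ) < cubeCount N n := fun n => by exact_mod_cast cubeCount_pos hN n
  refine le_dimH_of_hausdorffMeasure_ne_zero (d := u.toNNReal) ?_
  rw [Real.coe_toNNReal u hu.le]
  refine hausdorffMeasure_ne_zero_of_finite_covers
    (isCompact_limitSet.image V.starProjection.continuous) hu (sideLength_pos hM n₀)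
    (c := ((B : ℝ) ^ u)⁻¹) (by positivity) fun s O ρ hO hρ hdist hcov => ?_
  choose n hn₀ hnlt hnle using fun i => exists_sideLength_lt_le hM (hρ i).1 (hρ i).2
  classical
  set S : ℕ → Finset (Fin d → ℕ) := fun i =>
    (C (n i) ω).filter fun q => ∃ y ∈ cube M (n i) q, V.starProjection y ∈ O i with hS
  have hScard : ∀ i, ((S i).card : ℝ) * (gridSize M (n i) : ℝ) ^ u ≤ cubeCount N (n i) := by
    intro i
    rcases (S i).eq_empty_or_nonempty with h0 | h0
    · simp [h0]
    obtain ⟨A, hA, hSA⟩ := exists_subset_slab hM V hV (n i) h0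
      (fun j hj => hc.lt_gridSize hM (Finset.mem_filter.1 hj).1) (fun j hj j' hj' => by
        obtain ⟨y, hy, hyO⟩ := (Finset.mem_filter.1 hj).2
        obtain ⟨y', hy', hyO'⟩ := (Finset.mem_filter.1 hj').2
        exact ⟨y, hy, y', hy', (hdist i _ hyO _ hyO').trans (hnle i)⟩)
    refine le_trans ?_ (hslab (n i) (hn₀ i) A hA)
    refine mul_le_mul_of_nonneg_right ?_ (by have := hR (n i); positivity)
    exact_mod_cast Finset.card_le_card (Finset.subset_inter (Finset.filter_subset _ _) hSA)
  obtain ⟨m₀, hm₀⟩ := exists_stage_subset hc hM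
    (U := V.starProjection ⁻¹' ⋃ i ∈ s, O i)
    ((isOpen_biUnion fun i _ => hO i).preimage V.starProjection.continuous)
    (Set.image_subset_iff.1 hcov)
  -- a generation later than all those that correspond to the sets of the cover
  set m := max m₀ (s.sup n) with hm
  have hnm : ∀ i ∈ s, n i ≤ m := fun i hi => (Finset.le_sup hi).trans (le_max_right _ _)
  have hsub : C m ω ⊆ s.biUnion fun i =>
      (C m ω).filter fun j => ancestor (blockSize M (n i) m) j ∈ S i := by
    intro j hj
    have hcorner := corner_mem_cube hM m j
    have hmem := hm₀ m (le_max_left _ _) (Set.mem_iUnion₂.2 ⟨j, hj, hcorner⟩)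
    obtain ⟨i, hi, hiO⟩ := Set.mem_iUnion₂.1 hmem
    exact Finset.mem_biUnion.2 ⟨i, hi, Finset.mem_filter.2 ⟨hj, Finset.mem_filter.2
      ⟨hc.ancestor_mem hM (hnm i hi) hj, _, cube_subset_cube_ancestor hM (hnm i hi) j hcorner,
        hiO⟩⟩⟩
  have hcount : (cubeCount N m : ℝ) ≤ ∑ i ∈ s, (cubeCount N m : ℝ) * (B ^ u * ρ i ^ u) := by
    have h1 : (cubeCount N m : ℝ) ≤ ∑ i ∈ s,
        (((C m ω).filter fun j => ancestor (blockSize M (n i) m) j ∈ S i).card : ℝ) := by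
      rw [← hc.card_eq hM m]
      exact_mod_cast (Finset.card_le_card hsub).trans Finset.card_biUnion_le
    refine h1.trans (Finset.sum_le_sum fun i hi => ?_)
    have h2 : (((C m ω).filter fun j => ancestor (blockSize M (n i) m) j ∈ S i).card : ℝ)
        * cubeCount N (n i) = (S i).card * cubeCount N m := by
      exact_mod_cast hc.card_filter_ancestor hM (hnm i hi) (Finset.filter_subset _ _)
    have h3 : ((gridSize M (n i) : ℝ) ^ u)⁻¹ ≤ B ^ u * ρ i ^ u := by
      rw [← Real.inv_rpow (hR _).le, ← Real.mul_rpow hB0.le (hρ i).1.le, ← sideLength_eq]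
      refine Real.rpow_le_rpow (sideLength_pos hM _).le ?_ hu.le
      have h4 : sideLength M (n i) = M (n i) * sideLength M (n i + 1) := by
        have : (M (n i) : ℝ) ≠ 0 := by
          have := hM (n i); exact_mod_cast (show M (n i) ≠ 0 by omega)
        rw [sideLength_eq, sideLength_eq, gridSize_succ]
        push_cast
        field_simp
      rw [h4]
      exact mul_le_mul (by exact_mod_cast hB (n i)) (hnlt i).le (sideLength_pos hM _).le hB0.le
    have hRu : (0 : ℝ) < (gridSize M (n i) : ℝ) ^ u := Real.rpow_pos_of_pos (hR _) u
    have h5 : (((C m ω).filter fun j => ancestor (blockSize M (n i) m) j ∈ S i).card : ℝ)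
        ≤ cubeCount N m * ((gridSize M (n i) : ℝ) ^ u)⁻¹ := by
      rw [← div_eq_mul_inv, le_div_iff₀ hRu]
      refine le_of_mul_le_mul_right ?_ (hP (n i))
      calc _ = (S i).card * (gridSize M (n i) : ℝ) ^ u * cubeCount N m := by
            rw [mul_right_comm, h2]; ring
        _ ≤ cubeCount N (n i) * cubeCount N m :=
            mul_le_mul_of_nonneg_right (hScard i) (hP m).le
        _ = _ := mul_comm _ _
    exact h5.trans (mul_le_mul_of_nonneg_left h3 (hP m).le)
  rw [← Finset.mul_sum, ← Finset.mul_sum] at hcount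
  have hone := (le_mul_iff_one_le_right (hP m)).1 hcount
  rw [inv_le_iff_one_le_mul₀ (by positivity)]
  linarith

end hausdorff

section probability

open MeasureTheory Filter

variable {d k : ℕ} {M N : ℕ → ℕ} {Ω : Type*} [MeasurableSpace Ω] {P : Measure Ω}
  [IsProbabilityMeasure P] {C : ℕ → Ω → Finset (Fin d → ℕ)}

/-- The lower bound, almost surely for all subspaces of dimension `k ≥ s` at the same time. -/
theorem IsConstruction.ae_le_dimH_image_starProjection (hC : IsConstruction M N P C)
    (hM : ∀ n, 2 ≤ M n) {B : ℕ} (hB : ∀ n, M n ≤ B) (hN : ∀ n, 1 ≤ N n)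
    (hs : dimension M N ≤ k) :
    ∀ᵐ ω ∂P, ∀ V : Submodule ℝ (EuclideanSpace ℝ (Fin d)), Module.finrank ℝ V = k →
      ENNReal.ofReal (dimension M N) ≤ dimH (V.starProjection '' limitSet M C ω) := by
  -- countably many exponents suffice
  have hall : ∀ᵐ ω ∂P, ∀ u : ℚ, 0 < (u : ℝ) → (u : ℝ) < dimension M N →
      ∀ᶠ n : ℕ in atTop, ∀ A ∈ slabs d k (gridSize M n),
        ((C n ω ∩ A).card : ℝ) * (gridSize M n : ℝ) ^ (u : ℝ) ≤ cubeCount N n := by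
    refine ae_all_iff.2 fun u => ?_
    by_cases hu : 0 < (u : ℝ) ∧ (u : ℝ) < dimension M N
    · filter_upwards [hC.ae_eventually_card_inter_slab_mul_le hM hB hN hu.1.le hu.2 hs]
        with ω hω _ _ using hω
    · exact Eventually.of_forall fun ω h1 h2 => (hu ⟨h1, h2⟩).elim
  filter_upwards [hall] with ω hω V hV
  refine le_of_forall_lt_imp_le_of_dense fun b hb => ?_
  have hbt : b ≠ ⊤ := hb.ne_top
  have hbs : b.toReal < dimension M N := (ENNReal.lt_ofReal_iff_toReal_lt hbt).1 hb
  obtain ⟨u, hbu, hus⟩ := exists_rat_btwn hbs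
  have hu0 : 0 < (u : ℝ) := ENNReal.toReal_nonneg.trans_lt hbu
  obtain ⟨n₀, hn₀⟩ := eventually_atTop.1 (hω u hu0 hus)
  calc b = ENNReal.ofReal b.toReal := (ENNReal.ofReal_toReal hbt).symm
    _ ≤ ENNReal.ofReal u := ENNReal.ofReal_le_ofReal hbu.le
    _ ≤ _ := le_dimH_image_starProjection (hC.isTree ω) hM hB hN hu0 hn₀ V hV

end probability

end RandomCantor

theorem theorem2p2 {d k : ℕ} (M N : ℕ → ℕ)
    (hM : ∀ n, 2 ≤ M n) (hMbdd : ∃ B : ℕ, ∀ n, M n ≤ B)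
    (hN : ∀ n, 1 ≤ N n ∧ N n ≤ M n ^ d)
    {Ω : Type*} [MeasurableSpace Ω] (P : MeasureTheory.Measure Ω)
    [MeasureTheory.IsProbabilityMeasure P]
    (C : ℕ → Ω → Finset (Fin d → ℕ)) (hC : RandomCantor.IsConstruction M N P C)
    (hs : RandomCantor.dimension M N ≤ k) :
    ∀ᵐ ω ∂P,
      dimH (RandomCantor.limitSet M C ω) = ENNReal.ofReal (RandomCantor.dimension M N) ∧
      ∀ V : Submodule ℝ (EuclideanSpace ℝ (Fin d)), Module.finrank ℝ V = k →
        dimH (V.starProjection '' RandomCantor.limitSet M C ω)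
          = ENNReal.ofReal (RandomCantor.dimension M N) := by
  obtain ⟨B, hB⟩ := hMbdd
  have hN1 : ∀ n, 1 ≤ N n := fun n => (hN n).1
  filter_upwards [hC.ae_le_dimH_image_starProjection hM hB hN1 hs,
    hC.ae_le_dimH_image_starProjection (k := d) hM hB hN1 (RandomCantor.dimension_le hM hN)]
    with ω hk hd
  have hupper := RandomCantor.dimH_limitSet_le (hC.isTree ω) hM hN
  have hproj : ∀ V : Submodule ℝ (EuclideanSpace ℝ (Fin d)),
      dimH (V.starProjection '' RandomCantor.limitSet M C ω) ≤ dimH (RandomCantor.limitSet M C ω) :=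
    fun V => V.lipschitzWith_starProjection.dimH_image_le _
  -- the lower bound for the set itself is that for the projection to the whole space, as `s ≤ d`
  exact ⟨le_antisymm hupper ((hd ⊤ (by simp)).trans (hproj ⊤)),
    fun V hV => le_antisymm ((hproj V).trans hupper) (hk V hV)⟩
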